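/- Let $\mathfrak g=\mathfrak g_{\bar 0}\oplus\mathfrak g_{\bar 1}$ be a complex Lie superalgebra containing a copy of $\mathfrak{sl}_2\subset\mathfrak g_{\bar 0}$ with standard basis $e,h,f$ ($[h,e]=2e$, $[h,f]=-2f$, $[e,f]=h$) whose adjoint action on $\mathfrak g$ is locally finite. Then $\operatorname{ad}e,\operatorname{ad}f$ are locally nilpotent on the enveloping algebra $U(\mathfrak g)$, and $\{f^s\}_{s\ge 0}$ is an Ore set in it. For $a\in\mathbb C$ let $\phi_a$ be the automorphism $\phi_a(u)=\sum_{i\ge 0}\binom ai(\operatorname{ad}f)^i(u)f^{-i}$ of $U(\mathfrak g)[f^{-1}]$. For a $\mathbb Z/2$-graded $\mathfrak g$-module $N$ let $N[f^{-1}]=U(\mathfrak g)[f^{-1}]\otimes_{U(\mathfrak g)}N$, and let $\mathcal D_a(N)=\{f^a\otimes w: w\in N[f^{-1}]\}$ be the space $N[f^{-1}]$ with the twisted action $u(f^a\otimes w)=f^a\otimes\phi_{-a}(u)w$ (so that $f^au=\phi_a(u)f^a$), graded so that $f^a$ is even. The Enright functor is $$\mathcal C_a(N)=\{v\in\mathcal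 D_a(N):\dim\mathbb C[e]v<\infty\}.$$ Let $\mathcal M(a)^e$ be the category of $\mathfrak g$-modules on which $h$ acts diagonally with eigenvalues in $a+\mathbb Z$ and $e$ acts locally nilpotently. Let $\mathfrak h\subset\mathfrak g_{\bar 0}$ be an abelian Lie subalgebra containing $h$, and let $\alpha\in\mathfrak h^*$ satisfy $[x,e]=\alpha(x)e$ and $[x,f]=-\alpha(x)f$ for all $x\in\mathfrak h$. Write $\mathfrak{sl}_2(\alpha)$ for the span of $e,h,f$. For $\nu\in\mathfrak h^*$ put $N_\nu=\{v\in N:\forall x\in\mathfrak h\ \exists s\ (x-\nu(x))^sv=0\}$. We say that $N$ admits the $\mathfrak h$-character if $N$ is locally finite over $\mathfrak h$ and every $N_\nu$ is finite-dimensional; then, with a formal variable $\epsilon$ satisfying $\epsilon^2=1$, $$\operatorname{ch}_\epsilon N=\sum_{\nu\in\mathfrak h^*}\bigl(\dim (N_\nu)_{\bar 0}+\epsilon\dim (N_\nu)_{\bar 1}\bigr)e^\nu .$$ Put $r_\alpha\nu=\nu-\nu(h)\alpha$ and $r_\alpha\bigl(\sum_\nu a_\nu e^\nu\bigr)=\sum_\nu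 a_\nu e^{r_\alpha\nu}$. **Theorem.** Let $a\in\mathbb C\setminus\mathbb Z$ and let $N\in\mathcal M(a)^e$ be such that $N$ and $\mathcal C_a(N)$ admit the $\mathfrak h$-characters. Then: (i) $e^{\alpha/2}(1-e^{-\alpha})\operatorname{ch}_\epsilon\mathcal C_a(N)=r_\alpha\bigl(e^{\alpha/2}(1-e^{-\alpha})\operatorname{ch}_\epsilon N\bigr)$. (ii) If $\mathfrak g$ contains an $\operatorname{ad}\mathfrak h$-stable subalgebra $\mathfrak{osp}(1|2)$ with $\mathfrak{osp}(1|2)_{\bar 0}=\mathfrak{sl}_2(\alpha)$, then $$e^{\alpha/4}(1-\epsilon e^{-\alpha/2})\operatorname{ch}_\epsilon\mathcal C_a(N)=\epsilon\, r_\alpha\bigl(e^{\alpha/4}(1-\epsilon e^{-\alpha/2})\operatorname{ch}_\epsilon N\bigr).$$ -/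

import Mathlib

open scoped OreLocalization

noncomputable section

/-! ## Lie superalgebras over `ℂ` and their enveloping algebras -/

/-- The Koszul sign `(-1)^{ij}` for parities `i, j`. -/
def koszulSign (i j : ZMod 2) : ℂ := if i = 1 ∧ j = 1 then -1 else 1

/-- A complex Lie superalgebra structure on the vector space `g`. -/
class LieSuperalgebra (g : Type*) [AddCommGroup g] [Module ℂ g] where
  /-- the even (`0`) and the odd (`1`) part -/
  gr : ZMod 2 → Submodule ℂ g
  gr_internal : DirectSum.IsInternal gr
  /-- the superbracket -/
  br : g →ₗ[ℂ] g →ₗ[ℂ] g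
  br_mem : ∀ {i j : ZMod 2} {x y : g}, x ∈ gr i → y ∈ gr j → br x y ∈ gr (i + j)
  br_skew : ∀ {i j : ZMod 2} {x y : g}, x ∈ gr i → y ∈ gr j →
    br x y = -(koszulSign i j • br y x)
  br_jacobi : ∀ {i j : ZMod 2} {x y : g} (z : g), x ∈ gr i → y ∈ gr j →
    br x (br y z) = br (br x y) z + koszulSign i j • br y (br x z)

instance LieSuperalgebra.instBracket (g : Type*) [AddCommGroup g] [Module ℂ g]
    [LieSuperalgebra g] : Bracket g g := ⟨fun x y => LieSuperalgebra.br x y⟩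

open LieSuperalgebra

section Enveloping

variable (g : Type*) [AddCommGroup g] [Module ℂ g] [LieSuperalgebra g]

/-- The relations `x y = [x, y] + (-1)^{ij} y x` for homogeneous `x`, `y`. -/
inductive SuperEnvelopingRel : TensorAlgebra ℂ g → TensorAlgebra ℂ g → Prop
  | of {i j : ZMod 2} {x y : g} (hx : x ∈ gr i) (hy : y ∈ gr j) :
      SuperEnvelopingRel (TensorAlgebra.ι ℂ x * TensorAlgebra.ι ℂ y)
        (TensorAlgebra.ι ℂ ⁅x, y⁆
          + koszulSign i j • (TensorAlgebra.ι ℂ y * TensorAlgebra.ι ℂ x))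

/-- The universal enveloping algebra `U(g)`; a `g`-module is a module over `U(g)`. -/
def SuperU : Type _ := RingQuot (SuperEnvelopingRel g)

instance : Ring (SuperU g) := inferInstanceAs (Ring (RingQuot (SuperEnvelopingRel g)))

instance : Algebra ℂ (SuperU g) :=
  inferInstanceAs (Algebra ℂ (RingQuot (SuperEnvelopingRel g)))

/-- The canonical map `g → U(g)`. -/
def SuperU.ι : g →ₗ[ℂ] SuperU g :=
  (RingQuot.mkAlgHom ℂ (SuperEnvelopingRel g)).toLinearMap ∘ₗ TensorAlgebra.ι ℂ

variable {g}

theorem SuperU.ι_mul_ι {i j : ZMod 2} {x y : g} (hx : x ∈ gr i) (hy : y ∈ gr j) :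
    SuperU.ι g x * SuperU.ι g y
      = SuperU.ι g ⁅x, y⁆ + koszulSign i j • (SuperU.ι g y * SuperU.ι g x) := by
  have h := RingQuot.mkAlgHom_rel ℂ (SuperEnvelopingRel.of hx hy)
  rw [map_add, map_smul, map_mul, map_mul] at h
  exact h

theorem SuperU.induction {P : SuperU g → Prop}
    (hs : ∀ c : ℂ, P (algebraMap ℂ (SuperU g) c)) (hι : ∀ x : g, P (SuperU.ι g x))
    (hm : ∀ u v, P u → P v → P (u * v)) (ha : ∀ u v, P u → P v → P (u + v))
    (u : SuperU g) : P u := by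
  obtain ⟨t, rfl⟩ := RingQuot.mkAlgHom_surjective ℂ (SuperEnvelopingRel g) u
  induction t using TensorAlgebra.induction with
  | algebraMap r =>
    exact (congrArg P (AlgHom.commutes (RingQuot.mkAlgHom ℂ (SuperEnvelopingRel g)) r)).mpr (hs r)
  | ι x => exact hι x
  | mul a b iha ihb => rw [map_mul]; exact hm _ _ iha ihb
  | add a b iha ihb => rw [map_add]; exact ha _ _ iha ihb

end Enveloping

/-! ## The operator `ad f` on an associative algebra and the automorphisms `φ_a` -/

section AdOp

variable {A : Type*} [Ring A] [Algebra ℂ A]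

/-- `ad f : u ↦ f u - u f`. -/
def adOp (f : A) : A →ₗ[ℂ] A := LinearMap.mulLeft ℂ f - LinearMap.mulRight ℂ f

theorem adOp_apply (f u : A) : adOp f u = f * u - u * f := by simp [adOp]

theorem adOp_mul (f u v : A) : adOp f (u * v) = adOp f u * v + u * adOp f v := by
  simp only [adOp_apply]; noncomm_ring

theorem adOp_pow_zero_of_le {f u : A} {m n : ℕ} (h : m ≤ n) (hu : (adOp f ^ m) u = 0) :
    (adOp f ^ n) u = 0 := by
  obtain ⟨k, rfl⟩ := Nat.exists_eq_add_of_le' h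
  rw [pow_add, Module.End.mul_apply, hu, map_zero]

theorem adOp_pow_mul_zero (f : A) : ∀ (N m n : ℕ) (u v : A), m + n ≤ N → (adOp f ^ m) u = 0 →
    (adOp f ^ n) v = 0 → (adOp f ^ N) (u * v) = 0 := by
  intro N
  induction N with
  | zero =>
    intro m n u v h hu hv
    obtain rfl : m = 0 := by omega
    have : u = 0 := by simpa using hu
    simp [this]
  | succ N ih =>
    intro m n u v h hu hv
    rw [pow_succ, Module.End.mul_apply, adOp_mul, map_add]
    have h1 : (adOp f ^ N) (adOp f u * v) = 0 := by
      rcases m with _ | m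
      · have : u = 0 := by simpa using hu
        simp [this]
      · refine ih m n _ _ (by omega) ?_ hv
        rwa [pow_succ, Module.End.mul_apply] at hu
    have h2 : (adOp f ^ N) (u * adOp f v) = 0 := by
      rcases n with _ | n
      · have : v = 0 := by simpa using hv
        simp [this]
      · refine ih m n _ _ (by omega) hu ?_
        rwa [pow_succ, Module.End.mul_apply] at hv
    rw [h1, h2, add_zero]

theorem commute_adOp_mulRight (f : A) : Commute (adOp f) (LinearMap.mulRight ℂ f) := by
  ext u
  simp only [Module.End.mul_apply, LinearMap.mulRight_apply, adOp_apply]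
  noncomm_ring

/-- `f^s u = ∑ binom(s, i) (ad f)^i(u) f^{s-i}`. -/
theorem pow_mul_eq_sum_adOp (f u : A) (s : ℕ) :
    f ^ s * u = ∑ i ∈ Finset.range (s + 1), s.choose i • ((adOp f ^ i) u * f ^ (s - i)) := by
  have h : LinearMap.mulLeft ℂ f = adOp f + LinearMap.mulRight ℂ f := by simp [adOp]
  have h2 := congrArg (fun T : A →ₗ[ℂ] A => T u)
    ((congrArg (· ^ s) h).trans ((commute_adOp_mulRight f).add_pow s))
  simp only [LinearMap.pow_mulLeft, LinearMap.mulLeft_apply, LinearMap.sum_apply] at h2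
  rw [h2]
  refine Finset.sum_congr rfl fun i _ => ?_
  rw [(Commute.pow_pow (commute_adOp_mulRight f) i (s - i)).eq, ← nsmul_eq_mul',
    LinearMap.smul_apply, Module.End.mul_apply, LinearMap.pow_mulRight,
    LinearMap.mulRight_apply]

theorem pow_mul_eq_sum_adOp_of_nil {f u : A} {K : ℕ} (hK : (adOp f ^ K) u = 0) (s : ℕ) :
    f ^ s * u = ∑ i ∈ Finset.range K, s.choose i • ((adOp f ^ i) u * f ^ (s - i)) := by
  rw [pow_mul_eq_sum_adOp]
  have aux : ∀ M, K ≤ M → ∑ i ∈ Finset.range M, s.choose i • ((adOp f ^ i) u * f ^ (s - i))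
      = ∑ i ∈ Finset.range K, s.choose i • ((adOp f ^ i) u * f ^ (s - i)) := by
    intro M hM
    symm
    refine Finset.sum_subset (Finset.range_mono hM) fun i _ hi => ?_
    rw [adOp_pow_zero_of_le (by simpa using hi) hK, zero_mul, smul_zero]
  rw [← aux (max K (s + 1)) (le_max_left _ _)]
  refine Finset.sum_subset (Finset.range_mono (le_max_right _ _)) fun i _ hi => ?_
  rw [Nat.choose_eq_zero_of_lt (by simpa using hi), zero_smul]

/-- If `ad f` is locally nilpotent on `A` then `{f^s}` is an Ore set in `A`. -/
theorem nonempty_oreSet_powers (f : A) (hf : ∀ u : A, ∃ k : ℕ, (adOp f ^ k) u = 0) :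
    Nonempty (OreLocalization.OreSet (Submonoid.powers f)) := by
  rw [OreLocalization.nonempty_oreSet_iff]
  have key : ∀ (K n : ℕ) (u : A), (adOp f ^ K) u = 0 →
      f ^ (n + K) * u = (∑ i ∈ Finset.range K,
        (n + K).choose i • ((adOp f ^ i) u * f ^ (K - i))) * f ^ n := by
    intro K n u hK
    rw [pow_mul_eq_sum_adOp_of_nil hK, Finset.sum_mul]
    refine Finset.sum_congr rfl fun i hi => ?_
    have hi := Finset.mem_range.1 hi
    rw [smul_mul_assoc, mul_assoc, ← pow_add]
    congr 3
    omega
  constructor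
  · rintro r₁ r₂ ⟨s, n, rfl⟩ h
    obtain ⟨K, hK⟩ := hf (r₁ - r₂)
    have h0 : (r₁ - r₂) * f ^ n = 0 := by
      rw [sub_mul, sub_eq_zero]; exact h
    have hi : ∀ i, (adOp f ^ i) (r₁ - r₂) * f ^ n = 0 := by
      intro i
      have hc := Commute.pow_pow (commute_adOp_mulRight f) i n
      have := congrArg (fun T : A →ₗ[ℂ] A => T (r₁ - r₂)) hc.eq
      simp only [Module.End.mul_apply, LinearMap.pow_mulRight, LinearMap.mulRight_apply] at this
      rw [← this, h0, map_zero]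
    refine ⟨⟨f ^ (n + K), _, rfl⟩, ?_⟩
    rw [← sub_eq_zero, ← mul_sub, key K n _ hK, Finset.sum_mul]
    refine Finset.sum_eq_zero fun i _ => ?_
    rw [smul_mul_assoc, mul_assoc, ← pow_add, add_comm (K - i) n, pow_add, ← mul_assoc, hi,
      zero_mul, smul_zero]
  · rintro r ⟨s, n, rfl⟩
    obtain ⟨K, hK⟩ := hf r
    exact ⟨_, ⟨f ^ (n + K), _, rfl⟩, key K n r hK⟩

/-- `φ_a(u) = ∑ binom(a, i) (ad f)^i(u) f^{-i}`; the sum is finite when `ad f` is locally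
nilpotent. -/
def twistFun (f : Aˣ) (a : ℂ) (u : A) : A :=
  ∑ᶠ i : ℕ, Ring.choose a i • ((adOp (f : A) ^ i) u * (↑f⁻¹ : A) ^ i)

theorem twistFun_eq_sum (f : Aˣ) (a : ℂ) {u : A} {K : ℕ} (hK : (adOp (f : A) ^ K) u = 0) :
    twistFun f a u
      = ∑ i ∈ Finset.range K, Ring.choose a i • ((adOp (f : A) ^ i) u * (↑f⁻¹ : A) ^ i) := by
  refine finsum_eq_sum_of_support_subset _ fun i hi => ?_
  by_contra hn
  refine hi ?_
  show Ring.choose a i • ((adOp (f : A) ^ i) u * (↑f⁻¹ : A) ^ i) = 0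
  rw [adOp_pow_zero_of_le (by simpa using hn) hK, zero_mul, smul_zero]

theorem twistFun_natCast (f : Aˣ) {u : A} (hu : ∃ k : ℕ, (adOp (f : A) ^ k) u = 0) (s : ℕ) :
    twistFun f (s : ℂ) u = (f : A) ^ s * u * (↑f⁻¹ : A) ^ s := by
  obtain ⟨K, hK⟩ := hu
  rw [twistFun_eq_sum f _ hK, pow_mul_eq_sum_adOp_of_nil hK, Finset.sum_mul]
  refine Finset.sum_congr rfl fun i _ => ?_
  rw [Ring.choose_natCast, Nat.cast_smul_eq_nsmul]
  rcases le_or_gt i s with h | h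
  · rw [smul_mul_assoc, mul_assoc]
    congr 2
    obtain ⟨d, rfl⟩ := Nat.exists_eq_add_of_le h
    have h1 : (f : A) ^ d * (↑f⁻¹ : A) ^ d = 1 := by
      rw [← Units.val_pow_eq_pow_val, ← Units.val_pow_eq_pow_val, ← Units.val_mul, inv_pow,
        mul_inv_cancel, Units.val_one]
    rw [Nat.add_sub_cancel_left, add_comm i d, pow_add, ← mul_assoc, h1, one_mul]
  · rw [Nat.choose_eq_zero_of_lt h, zero_smul, zero_smul, zero_mul]

theorem exists_choose_poly (i : ℕ) : ∃ p : Polynomial ℂ, ∀ a : ℂ, p.eval a = Ring.choose a i := by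
  refine ⟨Polynomial.C ((i.factorial : ℂ)⁻¹) * descPochhammer ℂ i, fun a => ?_⟩
  rw [Ring.choose_eq_smul, Polynomial.eval_mul, Polynomial.eval_C, smul_eq_mul]
  congr 1
  rw [← descPochhammer_map (Int.castRingHom ℂ) i, Polynomial.eval_map]
  rw [Polynomial.eval₂_eq_sum, Polynomial.smeval_eq_sum]
  simp [Polynomial.sum, Polynomial.smul_pow]

theorem vec_poly_zero {ι : Type*} (s : Finset ι) (p : ι → Polynomial ℂ) (c : ι → A)
    (h : ∀ n : ℕ, ∑ i ∈ s, (p i).eval (n : ℂ) • c i = 0) (a : ℂ) :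
    ∑ i ∈ s, (p i).eval a • c i = 0 := by
  rw [← Module.forall_dual_apply_eq_zero_iff ℂ]
  intro l
  set P : Polynomial ℂ := ∑ i ∈ s, Polynomial.C (l (c i)) * p i with hP
  have hev : ∀ b : ℂ, P.eval b = l (∑ i ∈ s, (p i).eval b • c i) := by
    intro b
    simp [hP, Polynomial.eval_finsetSum, mul_comm]
  have : P = 0 := by
    refine Polynomial.eq_zero_of_infinite_isRoot P ?_
    refine (Set.infinite_range_of_injective (Nat.cast_injective (R := ℂ))).mono ?_
    rintro _ ⟨n, rfl⟩
    show P.eval (n : ℂ) = 0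
    rw [hev, h, map_zero]
  rw [← hev, this, Polynomial.eval_zero]

theorem twistFun_mul (f : Aˣ) (hf : ∀ u : A, ∃ k : ℕ, (adOp (f : A) ^ k) u = 0) (a : ℂ)
    (u v : A) : twistFun f a (u * v) = twistFun f a u * twistFun f a v := by
  choose q hq using exists_choose_poly
  obtain ⟨k, hk⟩ := hf u
  obtain ⟨l, hl⟩ := hf v
  obtain ⟨m, hm⟩ := hf (u * v)
  let p : (ℕ ⊕ ℕ × ℕ) → Polynomial ℂ := Sum.elim q fun ij => q ij.1 * q ij.2
  let c : (ℕ ⊕ ℕ × ℕ) → A := Sum.elim (fun i => (adOp (f : A) ^ i) (u * v) * (↑f⁻¹ : A) ^ i)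
    fun ij => -(((adOp (f : A) ^ ij.1) u * (↑f⁻¹ : A) ^ ij.1)
      * ((adOp (f : A) ^ ij.2) v * (↑f⁻¹ : A) ^ ij.2))
  have hsum : ∀ b : ℂ, ∑ x ∈ (Finset.range m).disjSum (Finset.range k ×ˢ Finset.range l),
      (p x).eval b • c x = twistFun f b (u * v) - twistFun f b u * twistFun f b v := by
    intro b
    rw [Finset.sum_disjSum, twistFun_eq_sum f b hk, twistFun_eq_sum f b hl,
      twistFun_eq_sum f b hm, Finset.sum_mul_sum, ← Finset.sum_product', sub_eq_add_neg,
      ← Finset.sum_neg_distrib]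
    simp only [p, c, Sum.elim_inl, Sum.elim_inr, Polynomial.eval_mul, hq, smul_neg,
      smul_mul_smul_comm]
  rw [← sub_eq_zero, ← hsum]
  refine vec_poly_zero _ p c (fun n => ?_) a
  rw [hsum, twistFun_natCast f ⟨m, hm⟩, twistFun_natCast f ⟨k, hk⟩, twistFun_natCast f ⟨l, hl⟩,
    sub_eq_zero]
  have h1 : (↑f⁻¹ : A) ^ n * (f : A) ^ n = 1 := by
    rw [← Units.val_pow_eq_pow_val, ← Units.val_pow_eq_pow_val, ← Units.val_mul, inv_pow,
      inv_mul_cancel, Units.val_one]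
  calc (f : A) ^ n * (u * v) * (↑f⁻¹ : A) ^ n
      = (f : A) ^ n * u * 1 * v * (↑f⁻¹ : A) ^ n := by noncomm_ring
    _ = _ := by rw [← h1]; simp only [mul_assoc]

theorem adOp_algebraMap (f : A) (c : ℂ) : adOp f (algebraMap ℂ A c) = 0 := by
  rw [adOp_apply, Algebra.commutes, sub_self]

/-- The automorphism `φ_a` of `A` attached to a unit `f` with `ad f` locally nilpotent. -/
def twistHom (f : Aˣ) (hf : ∀ u : A, ∃ k : ℕ, (adOp (f : A) ^ k) u = 0) (a : ℂ) :
    A →ₐ[ℂ] A where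
  toFun := twistFun f a
  map_one' := by
    rw [twistFun_eq_sum f a (K := 1) (by rw [pow_one, ← map_one (algebraMap ℂ A), adOp_algebraMap])]
    simp
  map_mul' := twistFun_mul f hf a
  map_zero' := by
    rw [twistFun_eq_sum f a (K := 0) (by simp)]; simp
  map_add' u v := by
    obtain ⟨k, hk⟩ := hf u
    obtain ⟨l, hl⟩ := hf v
    have hk := adOp_pow_zero_of_le (le_max_left k l) hk
    have hl := adOp_pow_zero_of_le (le_max_right k l) hl
    rw [twistFun_eq_sum f a hk, twistFun_eq_sum f a hl,
      twistFun_eq_sum f a (K := max k l) (by rw [map_add, hk, hl, add_zero]),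
      ← Finset.sum_add_distrib]
    simp only [map_add, add_mul, smul_add]
  commutes' c := by
    rw [twistFun_eq_sum f a (K := 1) (by rw [pow_one, adOp_algebraMap])]
    simp

end AdOp

/-! ## The copy of `sl₂`, localization and the Enright functor -/

/-- A copy of `sl₂` inside (the even part of) `g` with its standard basis `e, h, f`, acting
locally finitely on `g`. -/
structure Sl2Copy (g : Type*) [AddCommGroup g] [Module ℂ g] [LieSuperalgebra g] where
  e : g
  h : g
  f : g
  e_even : e ∈ gr (g := g) 0
  h_even : h ∈ gr (g := g) 0
  f_even : f ∈ gr (g := g) 0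
  lie_h_e : ⁅h, e⁆ = (2 : ℂ) • e
  lie_h_f : ⁅h, f⁆ = -((2 : ℂ) • f)
  lie_e_f : ⁅e, f⁆ = h
  h_ne_zero : h ≠ 0
  locallyFinite : ∀ x : g, ∃ W : Submodule ℂ g, FiniteDimensional ℂ W ∧ x ∈ W ∧
    ∀ w ∈ W, ⁅e, w⁆ ∈ W ∧ ⁅h, w⁆ ∈ W ∧ ⁅f, w⁆ ∈ W

section Nilpotent

/-- On a finite-dimensional space `[H, T] = c T` with `c ≠ 0` forces `T` to be nilpotent. -/
theorem nilpotent_of_comm {V : Type*} [AddCommGroup V] [Module ℂ V] [FiniteDimensional ℂ V]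
    (H T : Module.End ℂ V) (c : ℂ) (hc : c ≠ 0) (h : H * T - T * H = c • T) :
    ∃ k : ℕ, T ^ k = 0 := by
  by_contra! hT
  let D : Module.End ℂ (Module.End ℂ V) := LinearMap.mulLeft ℂ H - LinearMap.mulRight ℂ H
  have hD : ∀ X, D X = H * X - X * H := fun X => by simp [D]
  have hpow : ∀ n : ℕ, D (T ^ n) = ((n : ℂ) * c) • T ^ n := by
    intro n
    induction n with
    | zero => simp [hD]
    | succ n ih =>
      have : D (T ^ (n + 1)) = D (T ^ n) * T + T ^ n * (H * T - T * H) := by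
        simp only [hD, pow_succ]; noncomm_ring
      rw [this, ih, h, pow_succ]
      simp only [Algebra.smul_mul_assoc, Algebra.mul_smul_comm, Nat.cast_succ, add_mul, one_mul,
        add_smul]
  have hfin := Module.End.finite_hasEigenvalue D
  refine Set.infinite_of_injective_forall_mem (f := fun n : ℕ => (n : ℂ) * c) ?_ ?_ hfin
  · intro m n hmn
    exact Nat.cast_injective (mul_right_cancel₀ hc hmn)
  · intro n
    exact Module.End.hasEigenvalue_of_hasEigenvector
      (Module.End.hasEigenvector_iff.2 ⟨Module.End.mem_eigenspace_iff.2 (hpow n), hT n⟩)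

variable {g : Type*} [AddCommGroup g] [Module ℂ g] [LieSuperalgebra g]

theorem br_pow_zero {H T : g} (hH : H ∈ gr (g := g) 0) (hT : T ∈ gr (g := g) 0) {c : ℂ}
    (hc : c ≠ 0) (hHT : ⁅H, T⁆ = c • T) (x : g) (W : Submodule ℂ g) (hW : FiniteDimensional ℂ W)
    (hx : x ∈ W) (hWH : ∀ w ∈ W, ⁅H, w⁆ ∈ W) (hWT : ∀ w ∈ W, ⁅T, w⁆ ∈ W) :
    ∃ k : ℕ, (br T ^ k) x = 0 := by
  have hWH' : ∀ w ∈ W, br H w ∈ W := hWH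
  have hWT' : ∀ w ∈ W, br T w ∈ W := hWT
  obtain ⟨k, hk⟩ := nilpotent_of_comm ((br H).restrict hWH') ((br T).restrict hWT') c hc (by
    ext w
    have := br_jacobi (w : g) hH hT
    have hHT' : br H T = c • T := hHT
    simp [koszulSign, hHT'] at this
    simp [LinearMap.restrict_apply, this])
  refine ⟨k, ?_⟩
  have := congrArg (fun S : Module.End ℂ W => ((S ⟨x, hx⟩ : W) : g)) hk
  rw [Module.End.pow_restrict] at this
  exact this

theorem adOp_ι_nilpotent {T : g} (hT : T ∈ gr (g := g) 0)
    (hn : ∀ x : g, ∃ k : ℕ, (br T ^ k) x = 0) (u : SuperU g) :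
    ∃ k : ℕ, (adOp (SuperU.ι g T) ^ k) u = 0 := by
  have hgr : ∀ (i : ZMod 2) (x : g), x ∈ gr i →
      adOp (SuperU.ι g T) (SuperU.ι g x) = SuperU.ι g (br T x) := by
    intro i x hx
    rw [adOp_apply, SuperU.ι_mul_ι hT hx]
    simp [koszulSign]
    rfl
  have had : ∀ x : g, adOp (SuperU.ι g T) (SuperU.ι g x) = SuperU.ι g (br T x) := by
    intro x
    have hx : x ∈ ⨆ i, gr (g := g) i := by
      rw [(gr_internal (g := g)).submodule_iSup_eq_top]; trivial
    induction hx using Submodule.iSup_induction' with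
    | mem i x hx => exact hgr i x hx
    | zero => simp
    | add x y _ _ ihx ihy => simp only [map_add, ihx, ihy]
  induction u using SuperU.induction with
  | hs c => exact ⟨1, by rw [pow_one, adOp_algebraMap]⟩
  | hι x =>
    obtain ⟨k, hk⟩ := hn x
    refine ⟨k, ?_⟩
    have : ∀ n : ℕ, (adOp (SuperU.ι g T) ^ n) (SuperU.ι g x) = SuperU.ι g ((br T ^ n) x) := by
      intro n
      induction n with
      | zero => simp
      | succ n ih => rw [pow_succ', pow_succ', Module.End.mul_apply, ih, had, Module.End.mul_apply]
    rw [this, hk, map_zero]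
  | hm u v hu hv =>
    obtain ⟨m, hm⟩ := hu
    obtain ⟨n, hn⟩ := hv
    exact ⟨m + n, adOp_pow_mul_zero _ _ m n u v le_rfl hm hn⟩
  | ha u v hu hv =>
    obtain ⟨m, hm⟩ := hu
    obtain ⟨n, hn⟩ := hv
    exact ⟨max m n, by rw [map_add, adOp_pow_zero_of_le (le_max_left _ _) hm,
      adOp_pow_zero_of_le (le_max_right _ _) hn, add_zero]⟩

end Nilpotent

namespace Sl2Copy

variable {g : Type*} [AddCommGroup g] [Module ℂ g] [LieSuperalgebra g] (S : Sl2Copy g)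

theorem ad_e_nilpotent (u : SuperU g) : ∃ k : ℕ, (adOp (SuperU.ι g S.e) ^ k) u = 0 := by
  refine adOp_ι_nilpotent S.e_even (fun x => ?_) u
  obtain ⟨W, hW, hx, h⟩ := S.locallyFinite x
  exact br_pow_zero S.h_even S.e_even two_ne_zero S.lie_h_e x W hW hx
    (fun w hw => (h w hw).2.1) (fun w hw => (h w hw).1)

theorem ad_f_nilpotent (u : SuperU g) : ∃ k : ℕ, (adOp (SuperU.ι g S.f) ^ k) u = 0 := by
  refine adOp_ι_nilpotent S.f_even (fun x => ?_) u
  obtain ⟨W, hW, hx, h⟩ := S.locallyFinite x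
  exact br_pow_zero S.h_even S.f_even (c := -2) (by norm_num) (by rw [S.lie_h_f, neg_smul]) x W
    hW hx (fun w hw => (h w hw).2.1) (fun w hw => (h w hw).2.2)

/-- The Ore set `{f^s}` in `U(g)`. -/
def fPowers : Submonoid (SuperU g) := Submonoid.powers (SuperU.ι g S.f)

instance instOreSetFPowers : OreLocalization.OreSet S.fPowers :=
  Classical.choice (nonempty_oreSet_powers _ S.ad_f_nilpotent)

/-- The localization `U(g)[f⁻¹]`. -/
abbrev UInv : Type _ := OreLocalization S.fPowers (SuperU g)

/-- The element `f` as a unit of `U(g)[f⁻¹]`. -/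
def fUnit : (S.UInv)ˣ :=
  OreLocalization.numeratorUnit (⟨SuperU.ι g S.f, 1, pow_one _⟩ : S.fPowers)

theorem ad_fUnit_nilpotent (u : S.UInv) : ∃ k : ℕ, (adOp (S.fUnit : S.UInv) ^ k) u = 0 := by
  induction u using OreLocalization.ind with
  | _ r s =>
  obtain ⟨k, hk⟩ := S.ad_f_nilpotent r
  refine ⟨k, ?_⟩
  have hval : (S.fUnit : S.UInv) = OreLocalization.numeratorRingHom (SuperU.ι g S.f) := rfl
  have hcomm : Commute (S.fUnit : S.UInv) ((1 : SuperU g) /ₒ s) := by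
    obtain ⟨s, n, rfl⟩ := s
    have h : ((OreLocalization.numeratorUnit
        (⟨SuperU.ι g S.f ^ n, n, rfl⟩ : S.fPowers) : (S.UInv)ˣ) : S.UInv)
        = (S.fUnit : S.UInv) ^ n := by
      exact (map_pow (OreLocalization.numeratorRingHom : SuperU g →+* S.UInv)
        (SuperU.ι g S.f) n)
    have h2 : Commute (S.fUnit : S.UInv) ((OreLocalization.numeratorUnit
        (⟨SuperU.ι g S.f ^ n, n, rfl⟩ : S.fPowers) : (S.UInv)ˣ) : S.UInv) := by
      rw [h]; exact Commute.pow_right (Commute.refl _) n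
    exact h2.units_inv_right
  have hpow : ∀ n : ℕ, (adOp (S.fUnit : S.UInv) ^ n) (r /ₒ s)
      = ((1 : SuperU g) /ₒ s)
        * OreLocalization.numeratorRingHom ((adOp (SuperU.ι g S.f) ^ n) r) := by
    intro n
    induction n with
    | zero =>
      simp only [pow_zero, Module.End.one_apply]
      exact (by rw [OreLocalization.mul_div_one, one_mul] :
        ((1 : SuperU g) /ₒ s) * (r /ₒ (1 : S.fPowers)) = r /ₒ s).symm
    | succ n ih =>
      rw [pow_succ', pow_succ', Module.End.mul_apply, Module.End.mul_apply, ih, adOp_mul]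
      have : adOp (S.fUnit : S.UInv) ((1 : SuperU g) /ₒ s) = 0 := by
        rw [adOp_apply, hcomm.eq, sub_self]
      rw [this, zero_mul, zero_add, adOp_apply, adOp_apply, hval, map_sub, map_mul, map_mul]
  rw [hpow, hk, map_zero, mul_zero]

/-- The automorphism `φ_a` of `U(g)[f⁻¹]`, `φ_a(u) = ∑ binom(a, i) (ad f)^i(u) f^{-i}`. -/
def φ (a : ℂ) : S.UInv →ₐ[ℂ] S.UInv := twistHom S.fUnit S.ad_fUnit_nilpotent a

end Sl2Copy

section Enright

variable {g : Type*} [AddCommGroup g] [Module ℂ g] [LieSuperalgebra g] (S : Sl2Copy g)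

/-- The twisted localization `D_a(N)`. Its underlying space is `N[f⁻¹]`, the element `w` standing
for `f^a ⊗ w`. Since `f^a u = φ_a(u) f^a`, one has `u (f^a ⊗ w) = f^a ⊗ φ_{-a}(u) w`. -/
def TwistedLoc (_a : ℂ) (N : Type*) [AddCommGroup N] [Module (SuperU g) N] : Type _ :=
  OreLocalization S.fPowers N

variable (a : ℂ) (N : Type*) [AddCommGroup N] [Module (SuperU g) N]

instance : AddCommGroup (TwistedLoc S a N) :=
  inferInstanceAs (AddCommGroup (OreLocalization S.fPowers N))

instance : Module S.UInv (TwistedLoc S a N) :=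
  Module.compHom (OreLocalization S.fPowers N) (S.φ (-a)).toRingHom

instance : Module (SuperU g) (TwistedLoc S a N) :=
  Module.compHom (TwistedLoc S a N)
    (OreLocalization.numeratorRingHom : SuperU g →+* S.UInv)

variable [Module ℂ N] [IsScalarTower ℂ (SuperU g) N]

instance : Module ℂ (TwistedLoc S a N) :=
  inferInstanceAs (Module ℂ (OreLocalization S.fPowers N))

instance : IsScalarTower ℂ (SuperU g) (TwistedLoc S a N) where
  smul_assoc c u w := by
    have h : ∀ v : SuperU g, v • w = (show TwistedLoc S a N from
        (S.φ (-a) (OreLocalization.numeratorRingHom v) • (show OreLocalization S.fPowers N from w))) :=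
      fun _ => rfl
    have hc : (OreLocalization.numeratorRingHom (c • u) : S.UInv)
        = c • OreLocalization.numeratorRingHom u := by
      rw [Algebra.smul_def, map_mul, Algebra.smul_def]; rfl
    rw [h, h, hc, map_smul]
    exact smul_assoc c (S.φ (-a) (OreLocalization.numeratorRingHom u))
      (show OreLocalization S.fPowers N from w)

variable {N} in
/-- The element `f^a ⊗ f^{-s} v` of `D_a(N)`, where `f^s` is the given element of `{f^s}`. -/
def TwistedLoc.mk (v : N) (s : S.fPowers) : TwistedLoc S a N :=
  (v /ₒ s : OreLocalization S.fPowers N)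

variable {N} in
/-- The `ℤ/2`-grading of `D_a(N)`: `f^a` and `f⁻¹` are even. -/
def TwistedLoc.grading (gN : ZMod 2 → Submodule ℂ N) (i : ZMod 2) :
    Submodule ℂ (TwistedLoc S a N) :=
  Submodule.span ℂ {w | ∃ v ∈ gN i, ∃ s : S.fPowers, w = TwistedLoc.mk S a v s}

/-- The Zuckerman functor `Γ_e(M) = {v ∈ M | dim ℂ[e]v < ∞}`. -/
def zuckerman (M : Type*) [AddCommGroup M] [Module (SuperU g) M] [Module ℂ M]
    [IsScalarTower ℂ (SuperU g) M] : Submodule (SuperU g) M where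
  carrier := {v | FiniteDimensional ℂ
    (Submodule.span ℂ (Set.range fun n : ℕ => SuperU.ι g S.e ^ n • v))}
  zero_mem' := by
    have : Submodule.span ℂ (Set.range fun n : ℕ => SuperU.ι g S.e ^ n • (0 : M)) = ⊥ := by
      rw [Submodule.span_eq_bot]; rintro _ ⟨n, rfl⟩; simp
    show FiniteDimensional ℂ _
    rw [this]; infer_instance
  add_mem' := by
    intro v w (hv : FiniteDimensional ℂ _) (hw : FiniteDimensional ℂ _)
    show FiniteDimensional ℂ _
    refine Submodule.finiteDimensional_of_le (S₂ :=
      Submodule.span ℂ (Set.range fun n : ℕ => SuperU.ι g S.e ^ n • v) ⊔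
      Submodule.span ℂ (Set.range fun n : ℕ => SuperU.ι g S.e ^ n • w)) ?_
    rw [Submodule.span_le]
    rintro _ ⟨n, rfl⟩
    simp only [smul_add]
    exact Submodule.add_mem_sup (Submodule.subset_span ⟨n, rfl⟩) (Submodule.subset_span ⟨n, rfl⟩)
  smul_mem' := by
    intro u v (hv : FiniteDimensional ℂ _)
    obtain ⟨K, hK⟩ := S.ad_e_nilpotent u
    show FiniteDimensional ℂ _
    let W := Submodule.span ℂ (Set.range fun n : ℕ => SuperU.ι g S.e ^ n • v)
    let L : ℕ → (M →ₗ[ℂ] M) := fun i => Algebra.lsmul ℂ ℂ M ((adOp (SuperU.ι g S.e) ^ i) u)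
    refine Submodule.finiteDimensional_of_le (S₂ :=
      (Finset.range K).sup fun i => W.map (L i)) ?_
    rw [Submodule.span_le]
    rintro _ ⟨n, rfl⟩
    show SuperU.ι g S.e ^ n • u • v ∈ _
    rw [← mul_smul, pow_mul_eq_sum_adOp_of_nil hK, Finset.sum_smul]
    refine Submodule.sum_mem _ fun i hi => ?_
    rw [smul_assoc]
    refine Submodule.smul_of_tower_mem _ _ ?_
    refine (Finset.le_sup (f := fun i => W.map (L i)) hi : _ ≤ _) ?_
    rw [mul_smul]
    exact ⟨_, Submodule.subset_span ⟨n - i, rfl⟩, rfl⟩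

/-- The Enright functor `C_a(N) = Γ_e(D_a(N))`, as a submodule of `D_a(N)`. -/
def enright : Submodule (SuperU g) (TwistedLoc S a N) := zuckerman S (TwistedLoc S a N)

variable {N} in
/-- The `ℤ/2`-grading of `C_a(N)`, induced from `D_a(N)`. -/
def enrightGrading (gN : ZMod 2 → Submodule ℂ N) (i : ZMod 2) : Submodule ℂ (enright S a N) :=
  (TwistedLoc.grading S a gN i).comap ((enright S a N).subtype.restrictScalars ℂ)

end Enright

/-! ## Categories of modules and characters -/

section Characters

variable {g : Type*} [AddCommGroup g] [Module ℂ g] [LieSuperalgebra g]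
variable (N : Type*) [AddCommGroup N] [Module (SuperU g) N] [Module ℂ N]
  [IsScalarTower ℂ (SuperU g) N]

/-- The action of `x ∈ g` on a `g`-module. -/
def actOp (x : g) : Module.End ℂ N := Algebra.lsmul ℂ ℂ N (SuperU.ι g x)

variable {N} in
/-- `gN` is a `ℤ/2`-grading making the `g`-module `N` a supermodule. -/
structure IsSuperGrading (gN : ZMod 2 → Submodule ℂ N) : Prop where
  internal : DirectSum.IsInternal gN
  act_mem : ∀ {i j : ZMod 2} {x : g} {v : N}, x ∈ gr i → v ∈ gN j → actOp N x v ∈ gN (i + j)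

/-- Objects of `M(b)^e`: `h` acts diagonally with eigenvalues in `b + ℤ` and `e` acts locally
nilpotently. -/
structure IsInMe (S : Sl2Copy g) (b : ℂ) : Prop where
  diag : ⨆ n : ℤ, (actOp N S.h).eigenspace (b + n) = ⊤
  nilp : ∀ v : N, ∃ k : ℕ, (actOp N S.e ^ k) v = 0

variable (t : Submodule ℂ g)

/-- `N_ν = {v | ∀ x ∈ t, ∃ s, (x - ν(x))^s v = 0}`. -/
def wtSpace (ν : Module.Dual ℂ t) : Submodule ℂ N :=
  ⨅ x : t, (actOp N (x : g)).maxGenEigenspace (ν x)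

/-- `N` admits the `t`-character: `N` is locally finite over `t` and all the spaces `N_ν` are
finite-dimensional. -/
structure AdmitsChar : Prop where
  locallyFinite : ∀ v : N, ∃ W : Submodule ℂ N, FiniteDimensional ℂ W ∧ v ∈ W ∧
    ∀ x ∈ t, ∀ w ∈ W, actOp N x w ∈ W
  finite : ∀ ν : Module.Dual ℂ t, FiniteDimensional ℂ (wtSpace N t ν)

/-- `ℤ[ε]` with `ε² = 1`, the group ring of `ℤ/2`. -/
abbrev ZEps : Type := AddMonoidAlgebra ℤ (ZMod 2)

/-- The element `ε`. -/
def epsilon : ZEps := AddMonoidAlgebra.single 1 1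

/-- Formal, possibly infinite, sums `∑ a_ν e^ν` over `ν ∈ t*`, with `a_ν ∈ ℤ[ε]`. -/
abbrev FormalSum : Type _ := Module.Dual ℂ t → ZEps

/-- Finite formal sums, i.e. the group algebra of `t*` over `ℤ[ε]`. -/
abbrev FiniteSum : Type _ := AddMonoidAlgebra ZEps (Module.Dual ℂ t)

variable {t}

/-- The finite formal sum `e^μ`. -/
def fexp (μ : Module.Dual ℂ t) : FiniteSum t := AddMonoidAlgebra.single μ 1

/-- The scalar `ε` as a finite formal sum `ε e^0`. -/
def fepsilon : FiniteSum t := AddMonoidAlgebra.single 0 epsilon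

/-- The product of a finite formal sum with a formal sum, determined by `e^μ e^ν = e^{μ+ν}`. -/
def FiniteSum.act (p : FiniteSum t) (s : FormalSum t) : FormalSum t :=
  fun ν => p.coeff.sum fun μ c => c * s (ν - μ)

/-- `r_α ν = ν - ν(h) α`. -/
def reflectWt (h : t) (α ν : Module.Dual ℂ t) : Module.Dual ℂ t := ν - ν h • α

/-- `r_α (∑ a_ν e^ν) = ∑ a_ν e^{r_α ν}`: the coefficient of `e^μ` is the sum of the `a_ν` with
`r_α ν = μ` (there is exactly one such `ν` when `α(h) = 2`). -/
def FormalSum.reflect (h : t) (α : Module.Dual ℂ t) (s : FormalSum t) : FormalSum t :=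
  fun μ => ∑ᶠ ν ∈ {ν : Module.Dual ℂ t | reflectWt h α ν = μ}, s ν

variable {N} in
/-- `ch_ε N = ∑ (dim (N_ν)_even + ε dim (N_ν)_odd) e^ν`. -/
def chEps (t : Submodule ℂ g) (gN : ZMod 2 → Submodule ℂ N) : FormalSum t :=
  fun ν => AddMonoidAlgebra.single 0 (Module.finrank ℂ ↥(wtSpace N t ν ⊓ gN 0) : ℤ)
    + AddMonoidAlgebra.single 1 (Module.finrank ℂ ↥(wtSpace N t ν ⊓ gN 1) : ℤ)

end Characters

/-! ## Copies of `osp(1|2)` -/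

section Osp

variable {g : Type*} [AddCommGroup g] [Module ℂ g] [LieSuperalgebra g]

/-- `e, h, f` (even) and `E, F` (odd) satisfy the relations of the standard basis of `osp(1|2)`:
`E² = e`, `F² = -f`, `[E, F] = h`, where `E² = [E, E]/2`, and their consequences. -/
structure IsOspBasis (e h f E F : g) : Prop where
  E_odd : E ∈ gr (g := g) 1
  F_odd : F ∈ gr (g := g) 1
  lie_E_E : ⁅E, E⁆ = (2 : ℂ) • e
  lie_F_F : ⁅F, F⁆ = -((2 : ℂ) • f)
  lie_E_F : ⁅E, F⁆ = h
  lie_h_E : ⁅h, E⁆ = E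
  lie_h_F : ⁅h, F⁆ = -F
  lie_e_E : ⁅e, E⁆ = 0
  lie_e_F : ⁅e, F⁆ = -E
  lie_f_E : ⁅f, E⁆ = -F
  lie_f_F : ⁅f, F⁆ = 0
  lie_h_e : ⁅h, e⁆ = (2 : ℂ) • e
  lie_h_f : ⁅h, f⁆ = -((2 : ℂ) • f)
  lie_e_f : ⁅e, f⁆ = h

/-- `g` contains a copy of `osp(1|2)` whose even part is the given copy of `sl₂` and which is
stable under the bracket with `t`. The standard basis of `osp(1|2)` is not required to extend
the basis `S.e, S.h, S.f`. -/
def ContainsOsp (S : Sl2Copy g) (t : Submodule ℂ g) : Prop :=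
  ∃ e h f E F : g, IsOspBasis e h f E F ∧
    Submodule.span ℂ {e, h, f} = Submodule.span ℂ {S.e, S.h, S.f} ∧
    ∀ x ∈ t, ∀ y ∈ Submodule.span ℂ {e, h, f, E, F},
      ⁅x, y⁆ ∈ Submodule.span ℂ {e, h, f, E, F}

end Osp

end

/-! Both character identities count vectors killed by `e`. Let d_N(ν, i) be the dimension of the
parity `i` part of N_ν, and d_C the same for the Enright module.

All `h`-eigenvalues on N lie in `a + ℤ`, so they are not integers, and an `sl₂` computation shows
that `ef` is injective on every weight space. By finite-dimensionality `e` maps N_ν onto N_{ν+α},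
and rank-nullity makes d_N(ν, i) - d_N(ν + α, i) the dimension of the kernel of `e` on the parity
`i` part of N_ν. The same holds for the Enright module, where the eigenvalues lie in `-a + ℤ`
(`finrank_wtSpace_eq`).

The two kernels are matched by a complex power of `f`. If `v` has weight ν and `e v = 0`, then
f^{ν(h)+1} v is again killed by `e`. It makes sense in the twisted localization because ν(h) + 1
lies in `a + ℤ`, and its weight is ν - (ν(h)+1)α, that is, r_α ν - α. Conversely, every vector of
the right weight killed by `e` arises in this way (`exists_eq_twistedPow_of_e_eq_zero`,
`finrank_ker_e_eq`). Hence d_C(r_α ν - α, i) - d_C(r_α ν, i) = d_N(ν, i) - d_N(ν + α, i), which is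
(i) read coefficient by coefficient.

For (ii), `osp(1|2)` supplies an odd `E` of weight α/2 with `E² = e`
(`ContainsOsp.exists_odd_root_vector`). The surjection `e` factors through `E`, so dimensions
decrease along half-steps α/2 with a change of parity. What has to be shown is that the half-step
decrements match. By (i), the errors at two consecutive half-steps cancel, so the error only changes
sign along a string. Far out on the string d_C is stationary, and monotonicity forces the error to
vanish there, hence everywhere (`half_decrement_eq`). -/

noncomputable section

open LieSuperalgebra

/-! ### Coefficients of products and reflections of formal sums. -/

section FormalSums

variable {g : Type*} [AddCommGroup g] [Module ℂ g] {t : Submodule ℂ g}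

theorem FiniteSum.act_single (β : Module.Dual ℂ t) (c : ZEps) (s : FormalSum t)
    (ν : Module.Dual ℂ t) :
    FiniteSum.act (AddMonoidAlgebra.single β c) s ν = c * s (ν - β) := by
  simp [FiniteSum.act, AddMonoidAlgebra.coeff_single, Finsupp.sum_single_index]

theorem FiniteSum.act_sub (p q : FiniteSum t) (s : FormalSum t) (ν : Module.Dual ℂ t) :
    FiniteSum.act (p - q) s ν = FiniteSum.act p s ν - FiniteSum.act q s ν := by
  classical
  have h := Finsupp.sum_add_index' (f := (p - q).coeff) (g := q.coeff)
    (h := fun μ c => c * s (ν - μ)) (by simp) (by intros; rw [add_mul])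
  rw [← AddMonoidAlgebra.coeff_add, sub_add_cancel] at h
  exact eq_sub_of_add_eq h.symm

theorem act_fexp_mul_one_sub (β γ : Module.Dual ℂ t) (s : FormalSum t) (ν : Module.Dual ℂ t) :
    FiniteSum.act (fexp β * (1 - fexp γ)) s ν = s (ν - β) - s (ν - (β + γ)) := by
  have h : fexp β * (1 - fexp γ) = (AddMonoidAlgebra.single β 1 : FiniteSum t)
      - AddMonoidAlgebra.single (β + γ) 1 := by
    rw [mul_sub, mul_one, fexp, fexp, AddMonoidAlgebra.single_mul_single, one_mul]
  rw [h, FiniteSum.act_sub, FiniteSum.act_single, FiniteSum.act_single, one_mul, one_mul]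

theorem act_fexp_mul_one_sub_fepsilon (β γ : Module.Dual ℂ t) (s : FormalSum t)
    (ν : Module.Dual ℂ t) :
    FiniteSum.act (fexp β * (1 - fepsilon * fexp γ)) s ν
      = s (ν - β) - epsilon * s (ν - (β + γ)) := by
  have h : fexp β * (1 - fepsilon * fexp γ) = (AddMonoidAlgebra.single β 1 : FiniteSum t)
      - AddMonoidAlgebra.single (β + γ) epsilon := by
    rw [mul_sub, mul_one, fexp, fexp, fepsilon, AddMonoidAlgebra.single_mul_single,
      AddMonoidAlgebra.single_mul_single, one_mul, mul_one, zero_add]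
  rw [h, FiniteSum.act_sub, FiniteSum.act_single, FiniteSum.act_single, one_mul]

theorem act_fepsilon (s : FormalSum t) (ν : Module.Dual ℂ t) :
    FiniteSum.act fepsilon s ν = epsilon * s ν := by
  rw [fepsilon, FiniteSum.act_single, sub_zero]

variable {h : t} {α : Module.Dual ℂ t}

theorem reflectWt_apply (h : t) (α ν : Module.Dual ℂ t) (x : t) :
    reflectWt h α ν x = ν x - ν h * α x := rfl

theorem reflectWt_reflectWt (hα : α h = 2) (ν : Module.Dual ℂ t) :
    reflectWt h α (reflectWt h α ν) = ν := by
  ext x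
  simp only [reflectWt_apply, hα]
  ring

/-- Since r_α is an involution when α(h) = 2, the fibre over μ is the single point r_α μ. -/
theorem FormalSum.reflect_apply (hα : α h = 2) (s : FormalSum t) (μ : Module.Dual ℂ t) :
    FormalSum.reflect h α s μ = s (reflectWt h α μ) := by
  have : {ν : Module.Dual ℂ t | reflectWt h α ν = μ} = {reflectWt h α μ} := by
    ext ν
    simp only [Set.mem_ofPred_eq, Set.mem_singleton_iff]
    constructor
    · rintro rfl; exact (reflectWt_reflectWt hα ν).symm
    · rintro rfl; exact reflectWt_reflectWt hα μ
  rw [FormalSum.reflect, this]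
  exact finsum_mem_singleton

/-- The element `p + q ε` of `ℤ[ε]`. -/
def zeps (p q : ℤ) : ZEps := AddMonoidAlgebra.single 0 p + AddMonoidAlgebra.single 1 q

theorem zeps_sub (p q p' q' : ℤ) : zeps p q - zeps p' q' = zeps (p - p') (q - q') := by
  simp only [zeps, AddMonoidAlgebra.single_sub]
  abel

theorem epsilon_mul_zeps (p q : ℤ) : epsilon * zeps p q = zeps q p := by
  have : (1 : ZMod 2) + 1 = 0 := rfl
  simp only [zeps, epsilon, mul_add, AddMonoidAlgebra.single_mul_single, one_mul, add_zero, this]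
  abel

end FormalSums

/-! ### Combinatorics of dimension functions along root strings. -/

section Dimensions

variable {V : Type*} [AddCommGroup V] [Module ℂ V]

/-- A nonnegative integer function which decreases along `β`-strings is eventually constant on
each of them. -/
theorem exists_forall_eq_of_antitone_string (d : V → ℤ) (β : V) (hd : ∀ ν, 0 ≤ d ν)
    (hdec : ∀ ν, d (ν + β) ≤ d ν) (ν : V) :
    ∃ M : ℕ, ∀ n ≥ M, d (ν + (n : ℂ) • β) = d (ν + (n : ℂ) • β + β) := by
  have hs : ∀ n : ℕ, ν + ((n + 1 : ℕ) : ℂ) • β = ν + (n : ℂ) • β + β := by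
    intro n; push_cast; module
  have hanti : Antitone fun n : ℕ => (d (ν + (n : ℂ) • β)).toNat :=
    antitone_nat_of_succ_le fun n => by
      rw [hs]; exact Int.toNat_le_toNat (hdec _)
  obtain ⟨M, hM⟩ := WellFoundedGT.monotone_chain_condition
    (⟨fun n : ℕ => OrderDual.toDual (d (ν + (n : ℂ) • β)).toNat, fun _ _ h => hanti h⟩ : ℕ →o ℕᵒᵈ)
  refine ⟨M, fun n hn => ?_⟩
  have h1 : (d (ν + (M : ℂ) • β)).toNat = (d (ν + (n : ℂ) • β)).toNat := hM n hn
  have h2 : (d (ν + (M : ℂ) • β)).toNat = (d (ν + ((n + 1 : ℕ) : ℂ) • β)).toNat :=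
    hM (n + 1) (by omega)
  rw [hs] at h2
  have := hd (ν + (n : ℂ) • β)
  have := hd (ν + (n : ℂ) • β + β)
  omega

/-- If the reflection `r` matches the decrements of `dN` and `dC` along `α`-strings, and both
functions decrease along the `α/2`-strings with parity shift, then `r` matches the decrements
along the `α/2`-strings. -/
theorem half_decrement_eq {dN dC : V → ZMod 2 → ℤ} {r : V → V} {α : V}
    (hr : ∀ ν, r (r ν) = ν) (hrα : ∀ ν (c : ℂ), r (ν + c • α) = r ν - c • α)
    (hC0 : ∀ ν i, 0 ≤ dC ν i)
    (hNdec : ∀ ν i, dN (ν + (1 / 2 : ℂ) • α) (i + 1) ≤ dN ν i)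
    (hCdec : ∀ ν i, dC (ν + (1 / 2 : ℂ) • α) (i + 1) ≤ dC ν i)
    (hK : ∀ ν i, dC (r ν - α) i - dC (r ν) i = dN ν i - dN (ν + α) i) (μ : V) (i : ZMod 2) :
    dC μ i - dC (μ + (1 / 2 : ℂ) • α) (i + 1)
      = dN (r μ - (1 / 2 : ℂ) • α) (i + 1) - dN (r μ) i := by
  have hi : ∀ i : ZMod 2, i + 1 + 1 = i := by decide
  have half2 : ∀ ν : V, ν + (1 / 2 : ℂ) • α + (1 / 2 : ℂ) • α = ν + α := fun ν => by module
  have hCdec2 : ∀ ν i, dC (ν + α) i ≤ dC ν i := fun ν i => by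
    have := hCdec (ν + (1 / 2 : ℂ) • α) (i + 1)
    rw [half2, hi] at this
    exact this.trans (hCdec ν i)
  -- `A` is the error in the desired identity. The errors at μ and at μ + α/2 add up to the
  -- difference of the two sides of `hK'`, so they are opposite.
  let A : V → ZMod 2 → ℤ := fun μ i => dC μ i - dC (μ + (1 / 2 : ℂ) • α) (i + 1)
      - (dN (r μ - (1 / 2 : ℂ) • α) (i + 1) - dN (r μ) i)
  have hrα1 : ∀ ν, r (ν + α) = r ν - α := fun ν => by simpa using hrα ν 1
  have hK' : ∀ μ i, dC μ i - dC (μ + α) i = dN (r μ - α) i - dN (r μ) i := fun μ i => by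
    have := hK (r (μ + α)) i
    rwa [hr, add_sub_cancel_right, hrα1, sub_add_cancel] at this
  have hA : ∀ μ i, A (μ + (1 / 2 : ℂ) • α) (i + 1) = - A μ i := fun μ i => by
    have e1 : r μ - (1 / 2 : ℂ) • α - (1 / 2 : ℂ) • α = r μ - α := by module
    have := hK' μ i
    simp only [A, hi, half2, hrα, e1]
    linarith
  have hA1 : ∀ μ i, A (μ + α) i = A μ i := fun μ i => by
    have := hA (μ + (1 / 2 : ℂ) • α) (i + 1)
    rwa [half2, hi, hA, neg_neg] at this
  have hAn : ∀ n : ℕ, A (μ + (n : ℂ) • α) i = A μ i := fun n => by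
    induction n with
    | zero => simp
    | succ n ih =>
      rw [show μ + ((n + 1 : ℕ) : ℂ) • α = μ + (n : ℂ) • α + α by push_cast; module, hA1, ih]
  -- Two interlaced α-strings are needed: the one through μ with parity `i`, and the one through μ -
  -- α/2 with the other parity.
  obtain ⟨M₁, h₁⟩ := exists_forall_eq_of_antitone_string (fun ν => dC ν i) α
    (fun ν => hC0 ν i) (fun ν => hCdec2 ν i) μ
  obtain ⟨M₂, h₂⟩ := exists_forall_eq_of_antitone_string (fun ν => dC ν (i + 1)) α
    (fun ν => hC0 ν _) (fun ν => hCdec2 ν _) (μ - (1 / 2 : ℂ) • α)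
  have h₁ := h₁ (max M₁ M₂) (le_max_left _ _)
  have h₂ := h₂ (max M₁ M₂) (le_max_right _ _)
  have h₃ := hAn (max M₁ M₂)
  beta_reduce at h₁ h₂
  set ρ := μ + ((max M₁ M₂ : ℕ) : ℂ) • α with hρ
  have e2 : μ - (1 / 2 : ℂ) • α + ((max M₁ M₂ : ℕ) : ℂ) • α = ρ - (1 / 2 : ℂ) • α := by
    rw [hρ]; abel
  rw [e2] at h₂
  have c1 := hCdec ρ i
  have c2 := hCdec (ρ + (1 / 2 : ℂ) • α) (i + 1)
  rw [half2, hi] at c2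
  have e3 : ρ - (1 / 2 : ℂ) • α = ρ + (-(1 / 2) : ℂ) • α := by module
  have n1 := hNdec (r ρ - (1 / 2 : ℂ) • α) (i + 1)
  rw [sub_add_cancel, hi] at n1
  have n2 := hNdec (r ρ) i
  have n3 := hK' (ρ - (1 / 2 : ℂ) • α) (i + 1)
  have e4 : r (ρ - (1 / 2 : ℂ) • α) = r ρ + (1 / 2 : ℂ) • α := by
    rw [e3, hrα]; module
  have e5 : r ρ + (1 / 2 : ℂ) • α - α = r ρ - (1 / 2 : ℂ) • α := by module
  rw [e4, e5] at n3
  -- Each half of the error is squeezed. On the `dC` side the full step from ρ to ρ + α is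
  -- stationary, so both half-steps inside it are. On the `dN` side, `h₂` and `n3` make the full
  -- step from r ρ - α/2 to r ρ + α/2 stationary, and `n1`, `n2` bound its half-steps.
  have : A ρ i = 0 := by
    simp only [A]
    linarith
  rw [this] at h₃
  simp only [A] at h₃
  linarith

end Dimensions

/-! ## Weight spaces of modules -/

section EndLemmas

variable {P : Type*} [AddCommGroup P] [Module ℂ P]

/-- A shift operator carries generalized eigenvectors for `d` to generalized eigenvectors for `d +
c`, with the same exponent `k`. -/
theorem semiconj_sub_pow {X Y : Module.End ℂ P} {c d : ℂ} (h : X * Y = Y * X + c • Y) (k : ℕ)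
    (v : P) : ((X - algebraMap ℂ _ (d + c)) ^ k) (Y v) = Y (((X - algebraMap ℂ _ d) ^ k) v) := by
  have h1 : SemiconjBy Y (X - algebraMap ℂ _ d) (X - algebraMap ℂ _ (d + c)) := by
    rw [SemiconjBy, mul_sub, sub_mul, h, map_add, add_mul, ← Algebra.commutes, ← Algebra.smul_def c]
    abel
  exact (congrArg (fun T : Module.End ℂ P => T v) (h1.pow_right k).eq).symm

/-- In a representation of `sl₂`, the operator `ef` kills no `h`-eigenvector of non-integral
eigenvalue on which `e` is nilpotent. -/
theorem eq_zero_of_e_f_eq_zero {H E F : Module.End ℂ P} (hEF : E * F = F * E + H)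
    (hHE : H * E = E * H + (2 : ℂ) • E) {v : P} {μ : ℂ} (hμ : ∀ n : ℤ, μ ≠ n)
    (hv : H v = μ • v) {k : ℕ} (hk : (E ^ k) v = 0) (h0 : E (F v) = 0) : v = 0 := by
  have hEF' : ∀ w, F (E w) = E (F w) - H w := fun w =>
    eq_sub_of_add_eq (congrArg (fun T : Module.End ℂ P => T w) hEF).symm
  have hH : ∀ j : ℕ, H ((E ^ j) v) = (μ + 2 * j) • (E ^ j) v := fun j => by
    induction j with
    | zero => simp [hv]
    | succ j ih =>
      rw [pow_succ', Module.End.mul_apply]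
      have := congrArg (fun T : Module.End ℂ P => T ((E ^ j) v)) hHE
      simp only [Module.End.mul_apply, LinearMap.add_apply, LinearMap.smul_apply] at this
      rw [this, ih, map_smul]
      push_cast; module
  -- The scalar vanishes only for μ = -j, which is excluded. Thus `E^(j+1) v = 0` forces `E^j v =
  -- 0`, and one descends from `E^k v = 0` to `v = 0`.
  have hF : ∀ j : ℕ, F ((E ^ (j + 1)) v) = (-((j + 1) * (μ + j)) : ℂ) • (E ^ j) v := fun j => by
    induction j with
    | zero => simp [hEF', h0, hv]
    | succ j ih =>
      rw [pow_succ' E (j + 1), Module.End.mul_apply, hEF', ih, map_smul, hH, pow_succ',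
        Module.End.mul_apply]
      push_cast; module
  induction k with
  | zero => simpa using hk
  | succ j ih =>
    refine ih ?_
    have h := hF j
    rw [hk, map_zero] at h
    refine (smul_eq_zero.1 h.symm).resolve_left (neg_ne_zero.2 (mul_ne_zero ?_ ?_))
    · exact_mod_cast j.succ_ne_zero
    · intro h
      refine hμ (-j) ?_
      push_cast
      linear_combination h

theorem finrank_eq_finrank_inf_ker_add (T : Module.End ℂ P) (A : Submodule ℂ P)
    [FiniteDimensional ℂ A] :
    Module.finrank ℂ A
      = Module.finrank ℂ ↥(A ⊓ LinearMap.ker T) + Module.finrank ℂ (A.map T) := by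
  rw [← LinearMap.finrank_range_add_finrank_ker (T.domRestrict A), LinearMap.range_domRestrict,
    LinearMap.ker_domRestrict, add_comm, ← Submodule.map_comap_subtype,
    Submodule.finrank_map_subtype_eq]

/-- The composite `T U` is an injective endomorphism of the finite-dimensional space `B`, hence
surjective, so `T` already reaches all of `B`. -/
theorem map_comp_eq_self {T U : Module.End ℂ P} {A B : Submodule ℂ P} [FiniteDimensional ℂ B]
    (hU : ∀ v ∈ B, U v ∈ A) (hT : ∀ v ∈ A, T v ∈ B) (h : ∀ v ∈ B, T (U v) = 0 → v = 0) :
    A.map T = B := by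
  refine le_antisymm (Submodule.map_le_iff_le_comap.2 hT) ?_
  have hB : ∀ v ∈ B, (T * U) v ∈ B := fun v hv => hT _ (hU v hv)
  have hinj : Function.Injective ((T * U).restrict hB) :=
    (injective_iff_map_eq_zero _).2 fun v hv =>
      Subtype.ext (h v v.2 (congrArg Subtype.val hv))
  intro v hv
  obtain ⟨w, hw⟩ := LinearMap.surjective_of_injective hinj ⟨v, hv⟩
  exact ⟨U w, hU w w.2, congrArg Subtype.val hw⟩

end EndLemmas

section Modules

variable {g : Type*} [AddCommGroup g] [Module ℂ g] [LieSuperalgebra g]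
variable (P : Type*) [AddCommGroup P] [Module (SuperU g) P] [Module ℂ P]
  [IsScalarTower ℂ (SuperU g) P]

theorem actOp_smul (c : ℂ) (x : g) : actOp P (c • x) = c • actOp P x := by
  simp [actOp]

theorem actOp_neg (x : g) : actOp P (-x) = -actOp P x := by
  simp [actOp]

theorem actOp_mul_actOp {i j : ZMod 2} {x y : g} (hx : x ∈ gr i) (hy : y ∈ gr j) :
    actOp P x * actOp P y = actOp P ⁅x, y⁆ + koszulSign i j • (actOp P y * actOp P x) := by
  simp only [actOp, ← map_mul, SuperU.ι_mul_ι hx hy, map_add, map_smul]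

theorem actOp_mul_actOp_of_even {j : ZMod 2} {x y : g} (hx : x ∈ gr 0) (hy : y ∈ gr j) :
    actOp P x * actOp P y = actOp P y * actOp P x + actOp P ⁅x, y⁆ := by
  rw [actOp_mul_actOp P hx hy, koszulSign, if_neg (by simp), one_smul, add_comm]

theorem actOp_mul_self_of_odd {x z : g} (hx : x ∈ gr 1) (hxz : ⁅x, x⁆ = (2 : ℂ) • z) :
    actOp P x * actOp P x = actOp P z := by
  have h := actOp_mul_actOp P hx hx
  rw [koszulSign, if_pos ⟨rfl, rfl⟩, hxz, actOp_smul] at h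
  have h2 : (2 : ℂ) • (actOp P x * actOp P x) = (2 : ℂ) • actOp P z := by
    rw [two_smul]
    nth_rewrite 1 [h]
    rw [neg_smul, one_smul, neg_add_cancel_right]
  exact smul_right_injective _ (two_ne_zero' ℂ) h2

theorem mem_wtSpace {t : Submodule ℂ g} {ν : Module.Dual ℂ t} {v : P} :
    v ∈ wtSpace P t ν ↔
      ∀ x : t, ∃ k : ℕ, ((actOp P (x : g) - algebraMap ℂ _ (ν x)) ^ k) v = 0 := by
  simp only [wtSpace, Submodule.mem_iInf, Module.End.mem_maxGenEigenspace,
    Algebra.algebraMap_eq_smul_one]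

theorem actOp_mem_wtSpace {t : Submodule ℂ g} (t_even : t ≤ gr 0) {j : ZMod 2} {y : g}
    (hy : y ∈ gr j) {β : Module.Dual ℂ t} (hβ : ∀ x : t, ⁅(x : g), y⁆ = β x • y)
    {ν : Module.Dual ℂ t} {v : P} (hv : v ∈ wtSpace P t ν) :
    actOp P y v ∈ wtSpace P t (ν + β) := by
  rw [mem_wtSpace] at hv ⊢
  intro x
  obtain ⟨k, hk⟩ := hv x
  refine ⟨k, ?_⟩
  have h := actOp_mul_actOp_of_even P (t_even x.2) hy
  rw [hβ, actOp_smul] at h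
  rw [LinearMap.add_apply, semiconj_sub_pow h, hk, map_zero]

/-- The properties of the weight spaces of `P` which make `e` surjective between them: `h` acts
on `P_ν` by the scalar `ν(h)`, which is not an integer if `P_ν ≠ 0`, and `e` is locally nilpotent
on `P_ν`. -/
structure HasNonintegralWeights (S : Sl2Copy g) {t : Submodule ℂ g} (h_mem : S.h ∈ t) :
    Prop where
  h_act : ∀ {ν : Module.Dual ℂ t} {v : P}, v ∈ wtSpace P t ν → actOp P S.h v = ν ⟨S.h, h_mem⟩ • v
  nonint : ∀ {ν : Module.Dual ℂ t} {v : P}, v ∈ wtSpace P t ν → v ≠ 0 →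
    ∀ n : ℤ, ν ⟨S.h, h_mem⟩ ≠ n
  nilp : ∀ {ν : Module.Dual ℂ t} {v : P}, v ∈ wtSpace P t ν → ∃ k : ℕ, (actOp P S.e ^ k) v = 0

variable {P} {S : Sl2Copy g} {t : Submodule ℂ g} {h_mem : S.h ∈ t} {α : Module.Dual ℂ t}

/-- Here `f` leads back from weight ν + α to weight ν, and `ef` is injective on the target by
`eq_zero_of_e_f_eq_zero`. The subspace `G` will be a homogeneous part of the module. -/
theorem map_e_wtSpace (hP : HasNonintegralWeights P S h_mem) (t_even : t ≤ gr 0)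
    (hαe : ∀ x : t, ⁅(x : g), S.e⁆ = α x • S.e)
    (hαf : ∀ x : t, ⁅(x : g), S.f⁆ = -(α x • S.f)) {G : Submodule ℂ P}
    (hGe : ∀ v ∈ G, actOp P S.e v ∈ G) (hGf : ∀ v ∈ G, actOp P S.f v ∈ G)
    (ν : Module.Dual ℂ t) [FiniteDimensional ℂ (wtSpace P t (ν + α))] :
    (wtSpace P t ν ⊓ G).map (actOp P S.e) = wtSpace P t (ν + α) ⊓ G := by
  have hαf' : ∀ x : t, ⁅(x : g), S.f⁆ = (-α) x • S.f := fun x => by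
    rw [hαf, LinearMap.neg_apply, neg_smul]
  refine map_comp_eq_self (U := actOp P S.f) ?_ ?_ ?_
  · rintro v ⟨hv, hG⟩
    refine ⟨?_, hGf v hG⟩
    have := actOp_mem_wtSpace P t_even S.f_even hαf' hv
    rwa [add_neg_cancel_right] at this
  · rintro v ⟨hv, hG⟩
    exact ⟨actOp_mem_wtSpace P t_even S.e_even hαe hv, hGe v hG⟩
  · rintro v ⟨hv, -⟩ h0
    by_contra hne
    obtain ⟨k, hk⟩ := hP.nilp hv
    have hEF := actOp_mul_actOp_of_even P S.e_even S.f_even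
    have hHE := actOp_mul_actOp_of_even P S.h_even S.e_even
    rw [S.lie_e_f] at hEF
    rw [S.lie_h_e, actOp_smul] at hHE
    exact hne (eq_zero_of_e_f_eq_zero hEF hHE (hP.nonint hv hne) (hP.h_act hv) hk h0)

theorem finrank_wtSpace_eq (hP : HasNonintegralWeights P S h_mem) (t_even : t ≤ gr 0)
    (hαe : ∀ x : t, ⁅(x : g), S.e⁆ = α x • S.e)
    (hαf : ∀ x : t, ⁅(x : g), S.f⁆ = -(α x • S.f)) {G : Submodule ℂ P}
    (hGe : ∀ v ∈ G, actOp P S.e v ∈ G) (hGf : ∀ v ∈ G, actOp P S.f v ∈ G)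
    (hfin : ∀ ν, FiniteDimensional ℂ (wtSpace P t ν)) (ν : Module.Dual ℂ t) :
    Module.finrank ℂ ↥(wtSpace P t ν ⊓ G)
      = Module.finrank ℂ ↥(wtSpace P t ν ⊓ G ⊓ LinearMap.ker (actOp P S.e))
        + Module.finrank ℂ ↥(wtSpace P t (ν + α) ⊓ G) := by
  have := hfin ν
  have := hfin (ν + α)
  rw [finrank_eq_finrank_inf_ker_add (actOp P S.e), map_e_wtSpace hP t_even hαe hαf hGe hGf]

/-- The surjection `e = E²` from weight ν - α/2 to weight ν + α/2 factors through weight ν, so its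
second factor `E` is onto as well. -/
theorem finrank_wtSpace_half_le (hP : HasNonintegralWeights P S h_mem) (t_even : t ≤ gr 0)
    (hαe : ∀ x : t, ⁅(x : g), S.e⁆ = α x • S.e)
    (hαf : ∀ x : t, ⁅(x : g), S.f⁆ = -(α x • S.f)) {G G' : Submodule ℂ P}
    (hGe : ∀ v ∈ G', actOp P S.e v ∈ G') (hGf : ∀ v ∈ G', actOp P S.f v ∈ G')
    (hfin : ∀ ν, FiniteDimensional ℂ (wtSpace P t ν)) {E : g} (hE : E ∈ gr (g := g) 1)
    (hEE : ⁅E, E⁆ = (2 : ℂ) • S.e) (hαE : ∀ x : t, ⁅(x : g), E⁆ = ((1 / 2 : ℂ) • α) x • E)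
    (hGE : ∀ v ∈ G', actOp P E v ∈ G) (ν : Module.Dual ℂ t) :
    Module.finrank ℂ ↥(wtSpace P t (ν + (1 / 2 : ℂ) • α) ⊓ G')
      ≤ Module.finrank ℂ ↥(wtSpace P t ν ⊓ G) := by
  have h2 : ν + (1 / 2 : ℂ) • α = ν - (1 / 2 : ℂ) • α + α := by module
  have := hfin ν
  have := hfin (ν - (1 / 2 : ℂ) • α + α)
  have h1 : wtSpace P t (ν + (1 / 2 : ℂ) • α) ⊓ G' ≤ (wtSpace P t ν ⊓ G).map (actOp P E) := by
    rw [h2, ← map_e_wtSpace hP t_even hαe hαf hGe hGf, ← actOp_mul_self_of_odd P hE hEE]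
    rintro _ ⟨v, ⟨hv, hG⟩, rfl⟩
    refine ⟨actOp P E v, ⟨?_, hGE v hG⟩, rfl⟩
    have := actOp_mem_wtSpace P t_even hE hαE hv
    rwa [sub_add_cancel] at this
  exact (Submodule.finrank_mono h1).trans (Submodule.finrank_map_le _ _)

end Modules

/-! ## Commutation with powers of a unit -/

section UnitPowers

/-- Intended for X_n = φ_{-(a+n)}(u): it moves a twisted element past every integer power of `f`,
absorbing that power into the twist. -/
theorem mul_zpow_eq_zpow_mul {A : Type*} [Ring A] (f : Aˣ) (X : ℤ → A) (hX : ∀ n, X n * f = f * X (n + 1)) (n : ℤ) :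
    X 0 * ((f ^ n : Aˣ) : A) = ((f ^ n : Aˣ) : A) * X n := by
  induction n with
  | zero => simp
  | succ n ih =>
    rw [zpow_add_one, Units.val_mul, ← mul_assoc, ih, mul_assoc, hX, mul_assoc]
  | pred n ih =>
    have h := hX (-n - 1)
    rw [sub_add_cancel] at h
    have h2 : X (-n) * ((f⁻¹ : Aˣ) : A) = ((f⁻¹ : Aˣ) : A) * X (-n - 1) := by
      rw [Units.mul_inv_eq_iff_eq_mul, mul_assoc, h, Units.inv_mul_cancel_left]
    rw [zpow_sub_one, Units.val_mul, ← mul_assoc, ih, mul_assoc, h2, mul_assoc]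

variable {A : Type*} [Ring A] [Algebra ℂ A]

theorem twistFun_of_adOp_eq_smul (f : Aˣ) (a c : ℂ) {u : A} (hu : adOp (f : A) u = c • (f : A)) :
    twistFun f a u = u + algebraMap ℂ A (a * c) := by
  rw [twistFun_eq_sum f a (K := 2) (by
    rw [pow_two, Module.End.mul_apply, hu, map_smul, adOp_apply, sub_self, smul_zero])]
  simp only [Finset.sum_range_succ, Finset.sum_range_zero, Ring.choose_zero_right,
    Ring.choose_one_right, pow_zero, pow_one, Module.End.one_apply, hu, mul_one, one_smul, zero_add,
    smul_mul_assoc, Units.mul_inv, smul_smul, Algebra.algebraMap_eq_smul_one]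

theorem choose_neg_two (a : ℂ) : Ring.choose (-a) 2 = a * (a + 1) / 2 := by
  rw [Ring.choose_eq_smul]
  simp [descPochhammer_succ_right, Polynomial.smeval_mul, Polynomial.smeval_sub, Nat.factorial]
  ring

/-- The series stops after the quadratic term, since `(ad f)² e = -2f`. The linear term gives a
f⁻¹(h + 2) and the quadratic one -a(a + 1) f⁻¹. -/
theorem twistFun_of_sl2 (f : Aˣ) (a : ℂ) {e h : A} (he : e * f = f * e + h)
    (hh : h * f = f * h - (2 : ℂ) • (f : A)) :
    twistFun f (-a) e = e + a • ((↑f⁻¹ : A) * (h + algebraMap ℂ A (1 - a))) := by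
  have h1 : adOp (f : A) e = -h := by rw [adOp_apply, he]; abel
  have h2 : adOp (f : A) h = (2 : ℂ) • (f : A) := by rw [adOp_apply, hh]; abel
  have h4 : h * (↑f⁻¹ : A) = (↑f⁻¹ : A) * (h + algebraMap ℂ A 2) := by
    rw [Units.mul_inv_eq_iff_eq_mul, mul_assoc, add_mul, hh, Algebra.algebraMap_eq_smul_one,
      smul_mul_assoc, one_mul, sub_add_cancel, Units.inv_mul_cancel_left]
  have h3 : (adOp (f : A) ^ 2) e = -((2 : ℂ) • (f : A)) := by
    rw [pow_two, Module.End.mul_apply, h1, map_neg, h2]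
  have h5 : (f : A) * (↑f⁻¹ : A) ^ 2 = ↑f⁻¹ := by rw [pow_two, Units.mul_inv_cancel_left]
  rw [twistFun_eq_sum f (-a) (K := 3) (by
    rw [pow_succ', Module.End.mul_apply, h3, map_neg, map_smul, adOp_apply, sub_self, smul_zero,
      neg_zero])]
  simp only [Finset.sum_range_succ, Finset.sum_range_zero, Ring.choose_zero_right,
    Ring.choose_one_right, choose_neg_two, pow_zero, pow_one, Module.End.one_apply, h1, h3, h5, mul_one,
    one_smul, zero_add, neg_mul, smul_mul_assoc, h4, mul_add,
    Algebra.algebraMap_eq_smul_one, mul_smul_comm]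
  module

end UnitPowers

/-! ### The twisted localization and the vectors f^{a+n} v. -/

section Localization

variable {g : Type*} [AddCommGroup g] [Module ℂ g] [LieSuperalgebra g] (S : Sl2Copy g) (a : ℂ)
theorem numerator_smul_oreDiv_one {N : Type*} [AddCommGroup N] [Module (SuperU g) N]
    (u : SuperU g) (v : N) :
    (OreLocalization.numeratorRingHom u : S.UInv) • (v /ₒ 1 : OreLocalization S.fPowers N)
      = (u • v) /ₒ 1 :=
  OreLocalization.smul_div_one

variable (N : Type*) [AddCommGroup N] [Module (SuperU g) N] [Module ℂ N]
  [IsScalarTower ℂ (SuperU g) N]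

/-- The map `v ↦ f^a ⊗ f^n v` from `N` to `D_a(N)`. -/
def twistedPow (n : ℤ) : N →ₗ[ℂ] TwistedLoc S a N where
  toFun v := (((S.fUnit ^ n : (S.UInv)ˣ) : S.UInv) • (v /ₒ 1 : OreLocalization S.fPowers N) :)
  map_add' v w := by
    rw [← OreLocalization.add_oreDiv, smul_add]; rfl
  map_smul' c v := by
    rw [← OreLocalization.smul_oreDiv_one, smul_comm]; rfl

theorem coe_fUnit : (S.fUnit : S.UInv) = OreLocalization.numeratorRingHom (SuperU.ι g S.f) := rfl

variable {S a N}

theorem twistedPow_apply (n : ℤ) (v : N) : twistedPow S a N n v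
    = (((S.fUnit ^ n : (S.UInv)ˣ) : S.UInv) • (v /ₒ 1 : OreLocalization S.fPowers N) :) := rfl

theorem twistedPow_f (n : ℤ) (v : N) :
    twistedPow S a N n (actOp N S.f v) = twistedPow S a N (n + 1) v := by
  show ((S.fUnit ^ n : (S.UInv)ˣ) : S.UInv) • ((actOp N S.f v) /ₒ 1 : OreLocalization S.fPowers N)
    = ((S.fUnit ^ (n + 1) : (S.UInv)ˣ) : S.UInv) • (v /ₒ 1 : OreLocalization S.fPowers N)
  rw [zpow_add_one, Units.val_mul, mul_smul, coe_fUnit, numerator_smul_oreDiv_one]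
  rfl

theorem twistedLoc_mk_eq (v : N) (n : ℕ) (hn : SuperU.ι g S.f ^ n ∈ S.fPowers) :
    TwistedLoc.mk S a v ⟨SuperU.ι g S.f ^ n, hn⟩ = twistedPow S a N (-n) v := by
  have h : ((OreLocalization.numeratorUnit
      (⟨SuperU.ι g S.f ^ n, hn⟩ : S.fPowers) : (S.UInv)ˣ)) = S.fUnit ^ n :=
    Units.ext (map_pow (OreLocalization.numeratorRingHom : SuperU g →+* S.UInv)
        (SuperU.ι g S.f) n)
  show (v /ₒ _ : OreLocalization S.fPowers N)
    = ((S.fUnit ^ (-n : ℤ) : (S.UInv)ˣ) : S.UInv) • (v /ₒ 1 : OreLocalization S.fPowers N)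
  rw [zpow_neg, zpow_natCast, ← h]
  exact (by rw [OreLocalization.smul_div_one, one_smul] :
    (v /ₒ _ : OreLocalization S.fPowers N) = ((1 : SuperU g) /ₒ _) • (v /ₒ 1)).trans rfl

theorem exists_eq_twistedPow (w : TwistedLoc S a N) :
    ∃ (n : ℕ) (v : N), w = twistedPow S a N (-n) v := by
  induction w using OreLocalization.ind with
  | _ v s =>
    obtain ⟨s, n, rfl⟩ := s
    exact ⟨n, v, twistedLoc_mk_eq v n _⟩

/-- Powers of `f` are invertible after localization, and a fraction `v/1` vanishes only if some
power of `f` kills `v`. -/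
theorem twistedPow_injective (hf : Function.Injective (actOp N S.f)) (n : ℤ) :
    Function.Injective (twistedPow S a N n) := by
  rw [injective_iff_map_eq_zero]
  intro v hv
  have h : ((v /ₒ 1 : OreLocalization S.fPowers N)) = 0 := by
    have : ((S.fUnit ^ n : (S.UInv)ˣ) : S.UInv) • (v /ₒ 1 : OreLocalization S.fPowers N) = 0 := hv
    have h2 := congrArg (fun w => (((S.fUnit ^ n)⁻¹ : (S.UInv)ˣ) : S.UInv) • w) this
    simpa [smul_smul] using h2
  rw [OreLocalization.zero_def, OreLocalization.oreDiv_eq_iff] at h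
  obtain ⟨⟨u, m, rfl⟩, r, h1, h2⟩ := h
  rw [smul_zero] at h1
  simp only [mul_one, OneMemClass.coe_one] at h2
  rw [← h2] at h1
  have hpow : ∀ m : ℕ, SuperU.ι g S.f ^ m • v = ((actOp N S.f) ^ m) v := fun m => by
    induction m with
    | zero => simp
    | succ m ih => rw [pow_succ', pow_succ', Module.End.mul_apply, mul_smul, ih]; rfl
  have h3 : ((actOp N S.f) ^ m) v = 0 := by rw [← hpow]; exact h1.symm
  have := Function.Injective.iterate hf m
  rw [← Module.End.coe_pow] at this
  exact this (by rw [h3, map_zero])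

theorem numerator_algebraMap (c : ℂ) :
    (OreLocalization.numeratorRingHom (algebraMap ℂ (SuperU g) c) : S.UInv)
      = algebraMap ℂ S.UInv c := rfl

theorem numerator_smul (c : ℂ) (u : SuperU g) :
    (OreLocalization.numeratorRingHom (c • u) : S.UInv)
      = c • OreLocalization.numeratorRingHom u := by
  rw [Algebra.smul_def, map_mul, Algebra.smul_def, numerator_algebraMap]

theorem ι_mul_ι_of_even {j : ZMod 2} {x y : g} (hx : x ∈ gr (g := g) 0) (hy : y ∈ gr j) :
    SuperU.ι g x * SuperU.ι g y = SuperU.ι g y * SuperU.ι g x + SuperU.ι g ⁅x, y⁆ := by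
  rw [SuperU.ι_mul_ι hx hy, koszulSign, if_neg (by simp), one_smul, add_comm]

theorem numerator_mul_fUnit {x : g} (hx : x ∈ gr (g := g) 0) :
    (OreLocalization.numeratorRingHom (SuperU.ι g x) : S.UInv) * (S.fUnit : S.UInv)
      = (S.fUnit : S.UInv) * OreLocalization.numeratorRingHom (SuperU.ι g x)
        + OreLocalization.numeratorRingHom (SuperU.ι g ⁅x, S.f⁆) := by
  have h := congrArg (OreLocalization.numeratorRingHom : SuperU g →+* S.UInv)
    (ι_mul_ι_of_even hx S.f_even)
  rwa [map_add, map_mul, map_mul] at h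

theorem numerator_mul_fUnit_of_lie_eq {x : g} (hx : x ∈ gr (g := g) 0) {c : ℂ}
    (hxf : ⁅x, S.f⁆ = -(c • S.f)) :
    (OreLocalization.numeratorRingHom (SuperU.ι g x) : S.UInv) * (S.fUnit : S.UInv)
      = (S.fUnit : S.UInv) * OreLocalization.numeratorRingHom (SuperU.ι g x)
        - c • (S.fUnit : S.UInv) := by
  rw [numerator_mul_fUnit hx, hxf, map_neg, map_smul, map_neg, numerator_smul, sub_eq_add_neg,
    coe_fUnit]

theorem actOp_twistedPow_eq_smul {x : g} {n : ℤ} {u : S.UInv}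
    (h : S.φ (-a) (OreLocalization.numeratorRingHom (SuperU.ι g x))
      * ((S.fUnit ^ n : (S.UInv)ˣ) : S.UInv) = ((S.fUnit ^ n : (S.UInv)ˣ) : S.UInv) * u) (v : N) :
    actOp (TwistedLoc S a N) x (twistedPow S a N n v)
      = (((S.fUnit ^ n : (S.UInv)ˣ) : S.UInv) •
          (u • (v /ₒ 1 : OreLocalization S.fPowers N)) :) := by
  rw [← mul_smul, ← h, mul_smul]
  rfl

theorem numerator_add_algebraMap_smul (u : SuperU g) (c : ℂ) (v : N) :
    ((OreLocalization.numeratorRingHom u + algebraMap ℂ S.UInv c : S.UInv))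
      • (v /ₒ 1 : OreLocalization S.fPowers N) = (u • v + c • v) /ₒ 1 := by
  rw [add_smul, numerator_smul_oreDiv_one, algebraMap_smul, OreLocalization.smul_oreDiv_one,
    OreLocalization.add_oreDiv]

/-- Reading `twistedPow n v` as f^{a+n} v, this is the usual shift of a weight by -(a+n)c, now with
a complex exponent. -/
theorem actOp_twistedPow {x : g} (hx : x ∈ gr (g := g) 0) {c : ℂ} (hxf : ⁅x, S.f⁆ = -(c • S.f))
    (n : ℤ) (v : N) :
    actOp (TwistedLoc S a N) x (twistedPow S a N n v)
      = twistedPow S a N n (actOp N x v - ((a + n) * c) • v) := by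
  have hc := numerator_mul_fUnit_of_lie_eq hx hxf
  have h1 : S.φ (-a) (OreLocalization.numeratorRingHom (SuperU.ι g x))
      = OreLocalization.numeratorRingHom (SuperU.ι g x) + algebraMap ℂ S.UInv (-a * c) :=
    twistFun_of_adOp_eq_smul _ _ _ (by rw [adOp_apply, hc, sub_sub_cancel])
  have h2 := mul_zpow_eq_zpow_mul S.fUnit
    (fun n : ℤ => OreLocalization.numeratorRingHom (SuperU.ι g x)
      + algebraMap ℂ S.UInv (-(a + n) * c)) (fun n => by
        simp only [Algebra.algebraMap_eq_smul_one, add_mul, mul_add, hc, smul_mul_assoc,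
          mul_smul_comm, one_mul, mul_one]
        push_cast; module) n
  simp only [Int.cast_zero, add_zero] at h2
  rw [← h1] at h2
  rw [actOp_twistedPow_eq_smul h2, numerator_add_algebraMap_smul, neg_mul, neg_smul,
    ← sub_eq_add_neg]
  rfl

/-- The classical identity e f^m = f^m e + m f^{m-1}(h + 1 - m) continued to the exponent m = a + n.
-/
theorem actOp_e_twistedPow (n : ℤ) (v : N) :
    actOp (TwistedLoc S a N) S.e (twistedPow S a N n v)
      = twistedPow S a N n (actOp N S.e v)
        + (a + n) • twistedPow S a N (n - 1) (actOp N S.h v + (1 - (a + n)) • v) := by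
  have he := numerator_mul_fUnit (S := S) S.e_even
  rw [S.lie_e_f] at he
  have hh := numerator_mul_fUnit_of_lie_eq S.h_even S.lie_h_f
  have h1 : S.φ (-a) (OreLocalization.numeratorRingHom (SuperU.ι g S.e))
      = OreLocalization.numeratorRingHom (SuperU.ι g S.e)
        + a • (((S.fUnit⁻¹ : (S.UInv)ˣ) : S.UInv)
          * (OreLocalization.numeratorRingHom (SuperU.ι g S.h) + algebraMap ℂ S.UInv (1 - a))) :=
    twistFun_of_sl2 _ _ he hh
  have hh' : ∀ c : ℂ, (((S.fUnit⁻¹ : (S.UInv)ˣ) : S.UInv)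
          * (OreLocalization.numeratorRingHom (SuperU.ι g S.h) + algebraMap ℂ S.UInv c))
          * (S.fUnit : S.UInv)
        = OreLocalization.numeratorRingHom (SuperU.ι g S.h) + algebraMap ℂ S.UInv (c - 2) := by
    intro c
    rw [mul_assoc, Units.inv_mul_eq_iff_eq_mul, add_mul, hh]
    simp only [Algebra.algebraMap_eq_smul_one, mul_add, smul_mul_assoc,
          mul_smul_comm, one_mul, mul_one]
    module
  have h2 := mul_zpow_eq_zpow_mul S.fUnit
    (fun n : ℤ => OreLocalization.numeratorRingHom (SuperU.ι g S.e)
        + (a + n) • (((S.fUnit⁻¹ : (S.UInv)ˣ) : S.UInv)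
          * (OreLocalization.numeratorRingHom (SuperU.ι g S.h)
            + algebraMap ℂ S.UInv (1 - (a + n))))) (fun n => by
        rw [add_mul, smul_mul_assoc, hh', he, mul_add, mul_smul_comm, Units.mul_inv_cancel_left]
        simp only [Algebra.algebraMap_eq_smul_one]
        push_cast; module) n
  simp only [Int.cast_zero, add_zero] at h2
  rw [← h1] at h2
  rw [actOp_twistedPow_eq_smul h2, add_smul, smul_add, smul_assoc, smul_comm _ (a + n : ℂ),
    mul_smul, numerator_add_algebraMap_smul, numerator_smul_oreDiv_one, ← mul_smul, ← Units.val_mul,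
    ← zpow_sub_one]
  rfl

end Localization

/-! ### Diagonalizable operators and operators shifting their eigenvalues. -/

section Diagonalizable

variable {P : Type*} [AddCommGroup P] [Module ℂ P] {T : Module.End ℂ P} {ι : Type*} {c : ι → ℂ}

/-- Generalized eigenspaces are independent. Once honest eigenspaces span, the component of `v`
outside the μ-eigenspace lies both in the μ-space and in the sum of the others, so it is zero. -/
theorem eq_smul_of_mem_maxGenEigenspace (hT : ⨆ i, T.eigenspace (c i) = ⊤) {μ : ℂ} {v : P}
    (hv : v ∈ T.maxGenEigenspace μ) : T v = μ • v ∧ (v ≠ 0 → ∃ i, μ = c i) := by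
  have hdis := T.independent_maxGenEigenspace μ
  set X := ⨆ j, ⨆ (_ : j ≠ μ), T.maxGenEigenspace j
  have hX : ∀ i, c i ≠ μ → T.eigenspace (c i) ≤ X := fun i hi =>
    (T.genEigenspace_le_maximal (c i) 1).trans (le_iSup₂_of_le (c i) hi le_rfl)
  by_cases h : ∃ i, μ = c i
  · refine ⟨?_, fun _ => h⟩
    have hle : ⊤ ≤ T.eigenspace μ ⊔ X := by
      rw [← hT]
      refine iSup_le fun i => ?_
      by_cases hi : c i = μ
      · rw [hi]; exact le_sup_left
      · exact (hX i hi).trans le_sup_right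
    obtain ⟨x, hx, y, hy, rfl⟩ := Submodule.mem_sup.1 (hle (Submodule.mem_top (x := v)))
    have hy' : y ∈ T.maxGenEigenspace μ := by
      have := sub_mem hv (T.genEigenspace_le_maximal μ 1 hx)
      rwa [add_sub_cancel_left] at this
    rw [Submodule.disjoint_def.1 hdis y hy' hy, add_zero]
    exact Module.End.mem_eigenspace_iff.1 hx
  · have hle : ⊤ ≤ X := by
      rw [← hT]
      exact iSup_le fun i => hX i fun hi => h ⟨i, hi.symm⟩
    have : v = 0 := Submodule.disjoint_def.1 hdis v hv (hle Submodule.mem_top)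
    simp [this]

/-- An operator shifting the eigenvalues of a diagonalizable operator `T` is injective if it kills
no eigenvector of `T`. -/
theorem injective_of_shift_eigenvalue (hT : ⨆ i, T.eigenspace (c i) = ⊤)
    (hc : Function.Injective c) {F : Module.End ℂ P} {d : ℂ} (hF : T * F = F * T + d • F)
    (h : ∀ i v, T v = c i • v → F v = 0 → v = 0) : Function.Injective F := by
  classical
  rw [injective_iff_map_eq_zero]
  intro v hv
  obtain ⟨w, hw, rfl⟩ := (Submodule.mem_iSup_iff_exists_finsupp _ v).1
    (hT ▸ Submodule.mem_top : v ∈ ⨆ i, T.eigenspace (c i))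
  have hw : ∀ i, T (w i) = c i • w i := fun i => Module.End.mem_eigenspace_iff.1 (hw i)
  -- The images of the eigencomponents have distinct eigenvalues, so if their sum is zero, each of
  -- them is.
  have hind : iSupIndep fun i => T.eigenspace (c i + d) :=
    T.eigenspaces_iSupIndep.comp fun i j hij => hc (add_right_cancel hij)
  refine Finset.sum_eq_zero fun i hi => h i _ (hw i) ?_
  refine (iSupIndep_iff_finsetSum_eq_zero_imp_eq_zero _).1 hind w.support (fun i => F (w i))
    (fun i _ => ?_) ?_ i hi
  · have := congrArg (fun U : Module.End ℂ P => U (w i)) hF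
    simp only [Module.End.mul_apply, LinearMap.add_apply, LinearMap.smul_apply, hw, map_smul] at this
    rw [Module.End.mem_eigenspace_iff, this, add_smul]
  · rw [← map_sum]; exact hv

/-- Otherwise all `E^n v` would be eigenvectors of `T` with distinct eigenvalues, hence independent
in a finite-dimensional space. -/
theorem exists_pow_eq_zero_of_shift_eigenvalue {E : Module.End ℂ P} {d : ℂ} (hd : d ≠ 0)
    (hE : T * E = E * T + d • E) {v : P} {μ : ℂ} (hv : T v = μ • v)
    (hfin : FiniteDimensional ℂ (Submodule.span ℂ (Set.range fun n : ℕ => (E ^ n) v))) :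
    ∃ k : ℕ, (E ^ k) v = 0 := by
  by_contra! hne
  have hT : ∀ n : ℕ, T ((E ^ n) v) = (μ + n * d) • (E ^ n) v := fun n => by
    induction n with
    | zero => simp [hv]
    | succ n ih =>
      rw [pow_succ', Module.End.mul_apply]
      have := congrArg (fun U : Module.End ℂ P => U ((E ^ n) v)) hE
      simp only [Module.End.mul_apply, LinearMap.add_apply, LinearMap.smul_apply] at this
      rw [this, ih, map_smul]
      push_cast; module
  have hli := T.eigenvectors_linearIndependent' (fun n : ℕ => μ + n * d)
    (fun m n hmn => Nat.cast_injective (mul_right_cancel₀ hd (add_left_cancel hmn)))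
    (fun n => (E ^ n) v)
    (fun n => Module.End.hasEigenvector_iff.2 ⟨Module.End.mem_eigenspace_iff.2 (hT n), hne n⟩)
  exact not_finite_iff_infinite.2 (inferInstanceAs (Infinite ℕ))
    (Module.Finite.finite_basis (Module.Basis.span hli))

end Diagonalizable

/-! ### Weights of N and injectivity of `f` on it. -/

section Source

variable {g : Type*} [AddCommGroup g] [Module ℂ g] [LieSuperalgebra g] {S : Sl2Copy g} {a : ℂ}
variable {N : Type*} [AddCommGroup N] [Module (SuperU g) N] [Module ℂ N]
  [IsScalarTower ℂ (SuperU g) N] {t : Submodule ℂ g}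

theorem actOp_h_mul_e : actOp N S.h * actOp N S.e
    = actOp N S.e * actOp N S.h + (2 : ℂ) • actOp N S.e := by
  rw [actOp_mul_actOp_of_even N S.h_even S.e_even, S.lie_h_e, actOp_smul]

theorem actOp_h_mul_f : actOp N S.h * actOp N S.f
    = actOp N S.f * actOp N S.h + (-2 : ℂ) • actOp N S.f := by
  rw [actOp_mul_actOp_of_even N S.h_even S.f_even, S.lie_h_f, actOp_neg, actOp_smul, neg_smul]

theorem actOp_e_mul_f : actOp N S.e * actOp N S.f
    = actOp N S.f * actOp N S.e + actOp N S.h := by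
  rw [actOp_mul_actOp_of_even N S.e_even S.f_even, S.lie_e_f]

theorem add_intCast_ne_intCast (ha : ∀ n : ℤ, a ≠ n) (m n : ℤ) : a + m ≠ n := fun h =>
  ha (n - m) (by rw [Int.cast_sub, ← h, add_sub_cancel_right])

theorem IsInMe.wtSpace_h (hN : IsInMe N S a) (h_mem : S.h ∈ t) {ν : Module.Dual ℂ t} {v : N}
    (hv : v ∈ wtSpace N t ν) : actOp N S.h v = ν ⟨S.h, h_mem⟩ • v ∧
      (v ≠ 0 → ∃ n : ℤ, ν ⟨S.h, h_mem⟩ = a + n) :=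
  eq_smul_of_mem_maxGenEigenspace hN.diag ((Submodule.mem_iInf _).1 hv ⟨S.h, h_mem⟩)

theorem IsInMe.hasNonintegralWeights (hN : IsInMe N S a) (ha : ∀ n : ℤ, a ≠ n)
    (h_mem : S.h ∈ t) : HasNonintegralWeights N S h_mem where
  h_act hv := (hN.wtSpace_h h_mem hv).1
  nonint hv hne n := by
    obtain ⟨m, hm⟩ := (hN.wtSpace_h h_mem hv).2 hne
    rw [hm]
    exact add_intCast_ne_intCast ha m n
  nilp _ := hN.nilp _

theorem IsInMe.f_injective (hN : IsInMe N S a) (ha : ∀ n : ℤ, a ≠ n) :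
    Function.Injective (actOp N S.f) := by
  refine injective_of_shift_eigenvalue hN.diag (fun m n hmn => ?_) actOp_h_mul_f ?_
  · exact Int.cast_injective (add_left_cancel hmn)
  · intro n v hv h0
    obtain ⟨k, hk⟩ := hN.nilp v
    exact eq_zero_of_e_f_eq_zero actOp_e_mul_f actOp_h_mul_e (add_intCast_ne_intCast ha n) hv hk
      (by rw [h0, map_zero])

end Source

/-! ### Weights of the twisted localization and of the Enright module. -/

section Target

variable {g : Type*} [AddCommGroup g] [Module ℂ g] [LieSuperalgebra g] {S : Sl2Copy g} {a : ℂ}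
variable {N : Type*} [AddCommGroup N] [Module (SuperU g) N] [Module ℂ N]
  [IsScalarTower ℂ (SuperU g) N] {t : Submodule ℂ g} {α : Module.Dual ℂ t}

theorem twistedPow_f_pow (n : ℤ) (k : ℕ) (v : N) :
    twistedPow S a N n ((actOp N S.f ^ k) v) = twistedPow S a N (n + k) v := by
  induction k generalizing n with
  | zero => simp
  | succ k ih =>
    rw [pow_succ', Module.End.mul_apply, twistedPow_f, ih]
    congr 2
    push_cast; ring

theorem exists_eq_twistedPow_le (w : TwistedLoc S a N) (m : ℤ) :
    ∃ (k : ℕ) (v : N), w = twistedPow S a N (m - k) v := by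
  obtain ⟨n, v, rfl⟩ := exists_eq_twistedPow w
  -- The exponent `m - k` must not exceed `-n`; this is the least such `k`, and the remaining power
  -- of `f` is absorbed into the vector.
  refine ⟨(m + n).toNat, (actOp N S.f ^ (-n - (m - (m + n).toNat)).toNat) v, ?_⟩
  rw [twistedPow_f_pow]
  congr 2
  omega

theorem twistedPow_mem_wtSpace_iff (hf : Function.Injective (actOp N S.f)) (t_even : t ≤ gr 0)
    (hαf : ∀ x : t, ⁅(x : g), S.f⁆ = -(α x • S.f)) (n : ℤ) (ν : Module.Dual ℂ t) (v : N) :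
    twistedPow S a N n v ∈ wtSpace (TwistedLoc S a N) t (ν - (a + n) • α) ↔ v ∈ wtSpace N t ν := by
  have h : ∀ (x : t) (k : ℕ), ((actOp (TwistedLoc S a N) (x : g)
      - algebraMap ℂ _ ((ν - (a + n) • α) x)) ^ k) (twistedPow S a N n v)
        = twistedPow S a N n (((actOp N (x : g) - algebraMap ℂ _ (ν x)) ^ k) v) := fun x k => by
    induction k with
    | zero => simp
    | succ k ih =>
      rw [pow_succ', Module.End.mul_apply, ih, LinearMap.sub_apply,
        actOp_twistedPow (t_even x.2) (hαf x), pow_succ', Module.End.mul_apply,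
        LinearMap.sub_apply, LinearMap.sub_apply, Module.algebraMap_end_apply, Module.algebraMap_end_apply,
        ← map_smul (twistedPow S a N n), ← map_sub (twistedPow S a N n)]
      congr 1
      simp only [LinearMap.smul_apply, smul_eq_mul]
      module
  simp only [mem_wtSpace, h, map_eq_zero_iff _ (twistedPow_injective hf n)]

theorem coe_mem_wtSpace_iff {ν : Module.Dual ℂ t} {v : enright S a N} :
    (v : TwistedLoc S a N) ∈ wtSpace (TwistedLoc S a N) t ν ↔ v ∈ wtSpace (enright S a N) t ν := by
  have h : ∀ (x : t) (k : ℕ),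
      (((((actOp (enright S a N) (x : g) - algebraMap ℂ _ (ν x)) ^ k) v : enright S a N)) :
        TwistedLoc S a N)
        = ((actOp (TwistedLoc S a N) (x : g) - algebraMap ℂ _ (ν x)) ^ k) v := fun x k => by
    induction k with
    | zero => simp
    | succ k ih =>
      rw [pow_succ', pow_succ', Module.End.mul_apply, Module.End.mul_apply, ← ih]
      rfl
  simp only [mem_wtSpace, ← h, ZeroMemClass.coe_eq_zero]

/-- A single fraction f^{a-n} v represents the whole vector, and `v` has weight μ + (a-n)α. As α(h)
= 2, eigenvalues in `a + ℤ` become eigenvalues in `-a + ℤ`. -/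
theorem twistedLoc_wtSpace_h (hN : IsInMe N S a) (ha : ∀ n : ℤ, a ≠ n) (t_even : t ≤ gr 0)
    (h_mem : S.h ∈ t) (hαf : ∀ x : t, ⁅(x : g), S.f⁆ = -(α x • S.f)) (hα : α ⟨S.h, h_mem⟩ = 2)
    {μ : Module.Dual ℂ t} {w : TwistedLoc S a N}
    (hw : w ∈ wtSpace (TwistedLoc S a N) t μ) :
    actOp (TwistedLoc S a N) S.h w = μ ⟨S.h, h_mem⟩ • w ∧
      (w ≠ 0 → ∃ n : ℤ, μ ⟨S.h, h_mem⟩ = -a + n) := by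
  obtain ⟨n, v, rfl⟩ := exists_eq_twistedPow w
  have e : μ = μ + (a + ((-n : ℤ) : ℂ)) • α - (a + ((-n : ℤ) : ℂ)) • α := by abel
  rw [e, twistedPow_mem_wtSpace_iff (hN.f_injective ha) t_even hαf] at hw
  obtain ⟨h1, h2⟩ := hN.wtSpace_h h_mem hw
  simp only [LinearMap.add_apply, LinearMap.smul_apply, smul_eq_mul, hα] at h1 h2
  refine ⟨?_, fun hne => ?_⟩
  · rw [actOp_twistedPow S.h_even S.lie_h_f, h1, ← map_smul]
    congr 1
    module
  · obtain ⟨m, hm⟩ := h2 fun h => hne (by rw [h, map_zero])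
    refine ⟨m + 2 * n, ?_⟩
    push_cast at hm ⊢
    linear_combination hm

theorem enright_hasNonintegralWeights (hN : IsInMe N S a) (ha : ∀ n : ℤ, a ≠ n)
    (t_even : t ≤ gr 0) (h_mem : S.h ∈ t) (hαf : ∀ x : t, ⁅(x : g), S.f⁆ = -(α x • S.f))
    (hα : α ⟨S.h, h_mem⟩ = 2) : HasNonintegralWeights (enright S a N) S h_mem where
  h_act hv := Subtype.ext
    (twistedLoc_wtSpace_h hN ha t_even h_mem hαf hα (coe_mem_wtSpace_iff.2 hv)).1
  nonint hv hne n h := by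
    obtain ⟨m, hm⟩ := (twistedLoc_wtSpace_h hN ha t_even h_mem hαf hα
      (coe_mem_wtSpace_iff.2 hv)).2 fun h0 => hne (Subtype.ext h0)
    refine ha (m - n) ?_
    push_cast
    linear_combination hm - h
  nilp {ν v} hv := by
    have hfin : FiniteDimensional ℂ (Submodule.span ℂ (Set.range fun n : ℕ =>
      SuperU.ι g S.e ^ n • (v : TwistedLoc S a N))) := v.2
    have hpow : ∀ n : ℕ, ((actOp (enright S a N) S.e ^ n) v : enright S a N)
        = (actOp (TwistedLoc S a N) S.e ^ n) (v : TwistedLoc S a N) := fun n => by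
      induction n with
      | zero => simp
      | succ n ih => rw [pow_succ', pow_succ', Module.End.mul_apply, Module.End.mul_apply, ← ih]; rfl
    have hpow' : ∀ n : ℕ, SuperU.ι g S.e ^ n • (v : TwistedLoc S a N)
        = (actOp (TwistedLoc S a N) S.e ^ n) (v : TwistedLoc S a N) := fun n =>
      congrArg (fun T : Module.End ℂ (TwistedLoc S a N) => T v)
        (map_pow (Algebra.lsmul ℂ ℂ (TwistedLoc S a N)) (SuperU.ι g S.e) n)
    rw [funext hpow'] at hfin
    obtain ⟨k, hk⟩ := exists_pow_eq_zero_of_shift_eigenvalue two_ne_zero actOp_h_mul_e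
      (twistedLoc_wtSpace_h hN ha t_even h_mem hαf hα (coe_mem_wtSpace_iff.2 hv)).1 hfin
    exact ⟨k, Subtype.ext ((hpow k).trans hk)⟩

theorem mem_enright_of_e_eq_zero {w : TwistedLoc S a N} (hw : actOp (TwistedLoc S a N) S.e w = 0) :
    w ∈ enright S a N := by
  show FiniteDimensional ℂ (Submodule.span ℂ (Set.range fun n : ℕ => SuperU.ι g S.e ^ n • w))
  refine Submodule.finiteDimensional_of_le (S₂ := Submodule.span ℂ {w}) (Submodule.span_le.2 ?_)
  rintro _ ⟨n, rfl⟩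
  cases n with
  | zero => simp
  | succ n =>
    have : SuperU.ι g S.e • w = 0 := hw
    simp [pow_succ, mul_smul, this]

end Target

/-! ### The grading of the localization and its compatibility with the action. -/

section Grading

variable {g : Type*} [AddCommGroup g] [Module ℂ g] [LieSuperalgebra g] {S : Sl2Copy g} {a : ℂ}
variable {N : Type*} [AddCommGroup N] [Module (SuperU g) N] [Module ℂ N]
  [IsScalarTower ℂ (SuperU g) N] {gN : ZMod 2 → Submodule ℂ N}

theorem IsSuperGrading.isCompl (hgN : IsSuperGrading (g := g) gN) (i : ZMod 2) :
    IsCompl (gN i) (gN (i + 1)) :=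
  hgN.internal.isCompl (by revert i; decide) (by ext j; revert i j; decide)

theorem IsSuperGrading.even_act_mem (hgN : IsSuperGrading (g := g) gN) {i : ZMod 2} {x : g}
    (hx : x ∈ gr 0) {v : N} (hv : v ∈ gN i) : actOp N x v ∈ gN i := by
  simpa using hgN.act_mem hx hv

theorem IsSuperGrading.f_pow_mem (hgN : IsSuperGrading (g := g) gN) {i : ZMod 2} {v : N}
    (hv : v ∈ gN i) (k : ℕ) : (actOp N S.f ^ k) v ∈ gN i := by
  induction k with
  | zero => simpa
  | succ k ih => rw [pow_succ', Module.End.mul_apply]; exact hgN.even_act_mem S.f_even ih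

/-- Powers of the even injective operator `f` preserve both parities, so they cannot kill a
component of the wrong parity. -/
theorem IsSuperGrading.mem_of_f_pow_mem (hgN : IsSuperGrading (g := g) gN)
    (hf : Function.Injective (actOp N S.f)) {i : ZMod 2} {v : N} {k : ℕ}
    (hv : (actOp N S.f ^ k) v ∈ gN i) : v ∈ gN i := by
  obtain ⟨x, hx, y, hy, rfl⟩ := Submodule.mem_sup.1
    ((hgN.isCompl i).sup_eq_top ▸ Submodule.mem_top : v ∈ gN i ⊔ gN (i + 1))
  rw [map_add] at hv
  have h1 := (Submodule.add_mem_iff_right _ (hgN.f_pow_mem hx k)).1 hv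
  have h2 := Submodule.disjoint_def.1 (hgN.isCompl i).disjoint _ h1 (hgN.f_pow_mem hy k)
  have hinj := Function.Injective.iterate hf k
  rw [← Module.End.coe_pow] at hinj
  rw [hinj (h2.trans (map_zero _).symm), add_zero]
  exact hx

theorem mem_twistedLoc_grading (hgN : IsSuperGrading (g := g) gN) {i : ZMod 2}
    {w : TwistedLoc S a N} :
    w ∈ TwistedLoc.grading S a gN i ↔ ∃ n : ℕ, ∃ v ∈ gN i, w = twistedPow S a N (-n) v := by
  constructor
  · intro hw
    induction hw using Submodule.span_induction with
    | mem w hw =>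
      obtain ⟨v, hv, ⟨s, n, rfl⟩, rfl⟩ := hw
      exact ⟨n, v, hv, twistedLoc_mk_eq v n _⟩
    | zero => exact ⟨0, 0, zero_mem _, by simp⟩
    | add x y _ _ hx hy =>
      obtain ⟨m, v, hv, rfl⟩ := hx
      obtain ⟨n, w, hw, rfl⟩ := hy
      -- Common denominator f^{m+n}.
      refine ⟨m + n, (actOp N S.f ^ n) v + (actOp N S.f ^ m) w,
        add_mem (hgN.f_pow_mem hv n) (hgN.f_pow_mem hw m), ?_⟩
      rw [map_add, twistedPow_f_pow, twistedPow_f_pow]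
      congr 3 <;> push_cast <;> ring
    | smul c x _ hx =>
      obtain ⟨m, v, hv, rfl⟩ := hx
      exact ⟨m, c • v, Submodule.smul_mem _ _ hv, (map_smul _ _ _).symm⟩
  · rintro ⟨n, v, hv, rfl⟩
    exact Submodule.subset_span ⟨v, hv, ⟨_, n, rfl⟩, (twistedLoc_mk_eq v n _).symm⟩

theorem twistedPow_mem_grading_iff (hgN : IsSuperGrading (g := g) gN)
    (hf : Function.Injective (actOp N S.f)) {i : ZMod 2} {n : ℤ} {v : N} :
    twistedPow S a N n v ∈ TwistedLoc.grading S a gN i ↔ v ∈ gN i := by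
  rw [mem_twistedLoc_grading hgN]
  constructor
  · rintro ⟨m, w, hw, h⟩
    rcases le_total 0 (m + n) with h0 | h0
    · refine hgN.mem_of_f_pow_mem (S := S) hf (k := (m + n).toNat) ?_
      have h1 : twistedPow S a N (-m) ((actOp N S.f ^ (m + n).toNat) v)
          = twistedPow S a N (-m) w := by
        rw [twistedPow_f_pow, ← h]
        congr 2
        omega
      rw [twistedPow_injective hf _ h1]
      exact hw
    · have h1 : twistedPow S a N n v
          = twistedPow S a N n ((actOp N S.f ^ (-(m + n)).toNat) w) := by
        rw [twistedPow_f_pow, h]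
        congr 2
        omega
      rw [twistedPow_injective hf _ h1]
      exact hgN.f_pow_mem hw _
  · intro hv
    refine ⟨(-n).toNat, (actOp N S.f ^ n.toNat) v, hgN.f_pow_mem hv _, ?_⟩
    rw [twistedPow_f_pow]
    congr 2
    omega

variable (S a N) in
/-- The action of `U(g)[f⁻¹]` on `N[f⁻¹]`, before twisting. -/
def untwistedAct : S.UInv →ₐ[ℂ] Module.End ℂ (TwistedLoc S a N) :=
  Algebra.lsmul ℂ ℂ (OreLocalization S.fPowers N)

theorem actOp_eq_untwistedAct (x : g) : actOp (TwistedLoc S a N) x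
    = untwistedAct S a N (S.φ (-a) (OreLocalization.numeratorRingHom (SuperU.ι g x))) := rfl

theorem untwistedAct_zpow (m n : ℤ) (v : N) :
    untwistedAct S a N ((S.fUnit ^ m : (S.UInv)ˣ) : S.UInv) (twistedPow S a N n v)
      = twistedPow S a N (m + n) v := by
  rw [twistedPow_apply, twistedPow_apply, zpow_add, Units.val_mul, mul_smul]
  rfl

theorem untwistedAct_numerator (x : g) (v : N) :
    untwistedAct S a N (OreLocalization.numeratorRingHom (SuperU.ι g x)) (twistedPow S a N 0 v)
      = twistedPow S a N 0 (actOp N x v) := by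
  rw [twistedPow_apply, twistedPow_apply, zpow_zero, Units.val_one, one_smul, one_smul]
  exact numerator_smul_oreDiv_one (S := S) (SuperU.ι g x) v

theorem untwistedAct_zpow_mem (hgN : IsSuperGrading (g := g) gN)
    (hf : Function.Injective (actOp N S.f)) {i : ZMod 2} (m : ℤ) {w : TwistedLoc S a N}
    (hw : w ∈ TwistedLoc.grading S a gN i) :
    untwistedAct S a N ((S.fUnit ^ m : (S.UInv)ˣ) : S.UInv) w ∈ TwistedLoc.grading S a gN i := by
  obtain ⟨n, v, hv, rfl⟩ := (mem_twistedLoc_grading hgN).1 hw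
  rw [untwistedAct_zpow, twistedPow_mem_grading_iff hgN hf]
  exact hv

theorem f_mul_numerator {x : g} {i : ZMod 2} (hx : x ∈ gr i) :
    (S.fUnit : S.UInv) * (OreLocalization.numeratorRingHom (SuperU.ι g x) : S.UInv)
      = OreLocalization.numeratorRingHom (SuperU.ι g x) * (S.fUnit : S.UInv)
        + OreLocalization.numeratorRingHom (SuperU.ι g ⁅S.f, x⁆) := by
  have h := congrArg (OreLocalization.numeratorRingHom : SuperU g →+* S.UInv)
    (ι_mul_ι_of_even S.f_even hx)
  rwa [map_add, map_mul, map_mul] at h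

theorem br_f_pow_mem {x : g} {i : ZMod 2} (hx : x ∈ gr i) (k : ℕ) : (br S.f ^ k) x ∈ gr i := by
  induction k with
  | zero => simpa
  | succ k ih =>
    rw [pow_succ', Module.End.mul_apply]
    simpa using br_mem S.f_even ih

theorem exists_br_f_pow_eq_zero (S : Sl2Copy g) (x : g) : ∃ k : ℕ, (br S.f ^ k) x = 0 := by
  obtain ⟨W, hW, hx, h⟩ := S.locallyFinite x
  exact br_pow_zero S.h_even S.f_even (c := -2) (by norm_num) (by rw [S.lie_h_f, neg_smul]) x W
    hW hx (fun w hw => (h w hw).2.1) (fun w hw => (h w hw).2.2)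

/-- Double induction: on the order of nilpotency of `ad f` at `x`, then on the power of `f` in the
denominator of `w`. The relation `f x = x f + [f, x]` lowers one or the other. -/
theorem untwistedAct_numerator_mem (hgN : IsSuperGrading (g := g) gN)
    (hf : Function.Injective (actOp N S.f)) {i j : ZMod 2} {x : g} (hx : x ∈ gr i)
    {w : TwistedLoc S a N} (hw : w ∈ TwistedLoc.grading S a gN j) :
    untwistedAct S a N (OreLocalization.numeratorRingHom (SuperU.ι g x)) w
      ∈ TwistedLoc.grading S a gN (i + j) := by
  obtain ⟨k, hk⟩ := exists_br_f_pow_eq_zero S x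
  induction k generalizing x w with
  | zero =>
    have : x = 0 := by simpa using hk
    simp [this]
  | succ k ihk =>
    obtain ⟨n, v, hv, rfl⟩ := (mem_twistedLoc_grading hgN).1 hw
    induction n generalizing v with
    | zero =>
      rw [Nat.cast_zero, neg_zero, untwistedAct_numerator, twistedPow_mem_grading_iff hgN hf]
      exact hgN.act_mem hx hv
    | succ n ihn =>
      have hfx : ⁅S.f, x⁆ ∈ gr (g := g) i := br_f_pow_mem hx 1
      have hkf : (br S.f ^ k) ⁅S.f, x⁆ = 0 := by rwa [pow_succ, Module.End.mul_apply] at hk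
      have h1 := ihk hfx hw hkf
      have h2 := ihn v hv ((twistedPow_mem_grading_iff hgN hf).2 hv)
      have h3 := congrArg (fun u => untwistedAct S a N u (twistedPow S a N (-(n + 1 : ℕ)) v))
        (f_mul_numerator (S := S) hx)
      have h4 : (S.fUnit : S.UInv) = ((S.fUnit ^ (1 : ℤ) : (S.UInv)ˣ) : S.UInv) := by
        rw [zpow_one]
      simp only [map_mul, map_add, Module.End.mul_apply, LinearMap.add_apply] at h3
      rw [h4, untwistedAct_zpow] at h3
      have h5 : (1 : ℤ) + -(n + 1 : ℕ) = -n := by push_cast; ring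
      rw [h5] at h3
      -- So far `f x w` has the right parity; `f⁻¹` preserves parity and recovers `x w`.
      have h6 := untwistedAct_zpow_mem hgN hf (-1) (h3 ▸ add_mem h2 h1)
      rwa [← Module.End.mul_apply, ← map_mul, ← Units.val_mul, ← zpow_add, neg_add_cancel, zpow_zero,
        Units.val_one, map_one, Module.End.one_apply] at h6

theorem adOp_fUnit_pow_numerator {x : g} {i : ZMod 2} (hx : x ∈ gr i) (k : ℕ) :
    (adOp (S.fUnit : S.UInv) ^ k) (OreLocalization.numeratorRingHom (SuperU.ι g x))
      = OreLocalization.numeratorRingHom (SuperU.ι g ((br S.f ^ k) x)) := by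
  induction k with
  | zero => simp
  | succ k ih =>
    rw [pow_succ', pow_succ', Module.End.mul_apply, Module.End.mul_apply, ih, adOp_apply,
      f_mul_numerator (br_f_pow_mem hx k), add_sub_cancel_left]
    rfl

theorem actOp_mem_grading (hgN : IsSuperGrading (g := g) gN)
    (hf : Function.Injective (actOp N S.f)) {i j : ZMod 2} {x : g} (hx : x ∈ gr i)
    {w : TwistedLoc S a N} (hw : w ∈ TwistedLoc.grading S a gN j) :
    actOp (TwistedLoc S a N) x w ∈ TwistedLoc.grading S a gN (i + j) := by
  obtain ⟨k, hk⟩ := S.ad_fUnit_nilpotent (OreLocalization.numeratorRingHom (SuperU.ι g x))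
  have h : S.φ (-a) (OreLocalization.numeratorRingHom (SuperU.ι g x)) = _ :=
    twistFun_eq_sum _ _ hk
  rw [actOp_eq_untwistedAct, h, map_sum, LinearMap.sum_apply]
  refine sum_mem fun l _ => ?_
  rw [map_smul, LinearMap.smul_apply, adOp_fUnit_pow_numerator hx, map_mul, Module.End.mul_apply]
  refine Submodule.smul_mem _ _ (untwistedAct_numerator_mem hgN hf (br_f_pow_mem hx l) ?_)
  have : (↑(S.fUnit⁻¹) : S.UInv) ^ l = ((S.fUnit ^ (-l : ℤ) : (S.UInv)ˣ) : S.UInv) := by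
    rw [zpow_neg, zpow_natCast, ← inv_pow, Units.val_pow_eq_pow_val]
  rw [this]
  exact untwistedAct_zpow_mem hgN hf _ hw

theorem actOp_mem_enrightGrading (hgN : IsSuperGrading (g := g) gN)
    (hf : Function.Injective (actOp N S.f)) {i j : ZMod 2} {x : g} (hx : x ∈ gr i)
    {w : enright S a N} (hw : w ∈ enrightGrading S a gN j) :
    actOp (enright S a N) x w ∈ enrightGrading S a gN (i + j) :=
  actOp_mem_grading hgN hf hx hw

end Grading

/-! ### Vectors of the twisted localization killed by `e`. -/

section Singular

variable {g : Type*} [AddCommGroup g] [Module ℂ g] [LieSuperalgebra g] {S : Sl2Copy g} {a : ℂ}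
variable {N : Type*} [AddCommGroup N] [Module (SuperU g) N] [Module ℂ N]
  [IsScalarTower ℂ (SuperU g) N] {t : Submodule ℂ g} {α : Module.Dual ℂ t}

/-- A vector of `D_a(N)` killed by `e` whose `h`-eigenvalue is `-a - n - 1` has the form
`f^a ⊗ f^n v` with `v ∈ N`. -/
theorem exists_eq_twistedPow_of_e_eq_zero (ha : ∀ n : ℤ, a ≠ n)
    (hf : Function.Injective (actOp N S.f)) {n : ℤ}
    {w : TwistedLoc S a N} (hh : actOp (TwistedLoc S a N) S.h w = (-a - n - 1) • w)
    (he : actOp (TwistedLoc S a N) S.e w = 0) : ∃ v, w = twistedPow S a N n v := by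
  obtain ⟨k, v, rfl⟩ := exists_eq_twistedPow_le w n
  induction k generalizing v with
  | zero => exact ⟨v, by simp⟩
  | succ k ih =>
    set m : ℤ := n - (k + 1 : ℕ) with hm
    have hmc : (m : ℂ) = n - (k + 1) := by rw [hm]; push_cast; ring
    have hhv := hh
    rw [actOp_twistedPow S.h_even S.lie_h_f, ← map_smul] at hhv
    have hhv := sub_eq_iff_eq_add.1 (twistedPow_injective hf m hhv)
    have hev := he
    rw [actOp_e_twistedPow, hhv] at hev
    -- In the formula for e f^{a+m} v the scalar h + 1 - (a+m) equals m - n = -(k+1). Cancelling the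
    -- power of `f` makes `f e v` a nonzero multiple of `v`, because `a` is not an integer. So `v`
    -- lies in `f N`, and one denominator can be removed.
    have h1 : actOp N S.f (actOp N S.e v)
        + ((a + m) * (-(k + 1))) • v = 0 := by
      refine twistedPow_injective (a := a) hf (m - 1) ?_
      rw [map_add, twistedPow_f, sub_add_cancel, map_zero, ← hev, mul_smul, map_smul]
      congr 3
      rw [hmc]
      module
    have hne : (a + m) * (-(k + 1) : ℂ) ≠ 0 := by
      refine mul_ne_zero (fun h => ha (-m) ?_) (neg_ne_zero.2 (by exact_mod_cast k.succ_ne_zero))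
      push_cast
      linear_combination h
    set c := (a + m) * (-(k + 1) : ℂ)
    have hv : v = actOp N S.f (-c⁻¹ • actOp N S.e v) := by
      rw [map_smul, eq_neg_of_add_eq_zero_left h1, smul_neg, neg_smul, neg_neg,
        inv_smul_smul₀ hne]
    have hmk : m + 1 = n - k := by rw [hm]; push_cast; ring
    have hw : twistedPow S a N m v = twistedPow S a N (n - k) (-c⁻¹ • actOp N S.e v) := by
      rw [← hmk, ← twistedPow_f, ← hv]
    rw [hw] at hh he ⊢
    exact ih _ hh he

end Singular

/-! ### Matching the kernels of `e` on N and on the Enright module. -/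

section SingularDimension

variable {g : Type*} [AddCommGroup g] [Module ℂ g] [LieSuperalgebra g] {S : Sl2Copy g} {a : ℂ}
variable {N : Type*} [AddCommGroup N] [Module (SuperU g) N] [Module ℂ N]
  [IsScalarTower ℂ (SuperU g) N] {t : Submodule ℂ g} {α : Module.Dual ℂ t}
  {gN : ZMod 2 → Submodule ℂ N}

/-- The bijection is v ↦ f^{ν(h)+1} v, and it preserves parity since `f^a` is even. When ν(h) is not
in `a + ℤ`, both weight spaces vanish. -/
theorem finrank_ker_e_eq (hN : IsInMe N S a) (ha : ∀ n : ℤ, a ≠ n) (t_even : t ≤ gr 0)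
    (h_mem : S.h ∈ t) (hαf : ∀ x : t, ⁅(x : g), S.f⁆ = -(α x • S.f)) (hα : α ⟨S.h, h_mem⟩ = 2)
    (hgN : IsSuperGrading (g := g) gN) (ν : Module.Dual ℂ t) (i : ZMod 2) :
    Module.finrank ℂ ↥(wtSpace N t ν ⊓ gN i ⊓ LinearMap.ker (actOp N S.e))
      = Module.finrank ℂ ↥(wtSpace (enright S a N) t (reflectWt ⟨S.h, h_mem⟩ α ν - α)
          ⊓ enrightGrading S a gN i ⊓ LinearMap.ker (actOp (enright S a N) S.e)) := by
  have hf := hN.f_injective ha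
  by_cases hν : ∃ n : ℤ, ν ⟨S.h, h_mem⟩ = a + n - 1
  -- The offset -1 makes a + n = ν(h) + 1, the exponent at which h + 1 - (a+n) kills `v`.
  · obtain ⟨n, hn⟩ := hν
    have hμ : reflectWt ⟨S.h, h_mem⟩ α ν - α = ν - (a + n) • α := by
      rw [reflectWt, hn]; module
    have hμh : (ν - (a + n) • α) ⟨S.h, h_mem⟩ = -a - n - 1 := by
      simp only [LinearMap.sub_apply, LinearMap.smul_apply, smul_eq_mul, hα, hn]; ring
    rw [hμ]
    have h0 : (a + n - 1 + (1 - (a + n)) : ℂ) = 0 := by ring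
    have hmap : (wtSpace N t ν ⊓ gN i ⊓ LinearMap.ker (actOp N S.e)).map (twistedPow S a N n)
        = (wtSpace (enright S a N) t (ν - (a + n) • α) ⊓ enrightGrading S a gN i
            ⊓ LinearMap.ker (actOp (enright S a N) S.e)).map
          ((enright S a N).subtype.restrictScalars ℂ) := by
      ext w
      constructor
      · rintro ⟨v, ⟨⟨hv, hg⟩, he⟩, rfl⟩
        have hew : actOp (TwistedLoc S a N) S.e (twistedPow S a N n v) = 0 := by
          rw [actOp_e_twistedPow, LinearMap.mem_ker.1 he, (hN.wtSpace_h h_mem hv).1, hn, map_zero,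
            zero_add, ← add_smul, h0, zero_smul, map_zero, smul_zero]
        exact ⟨⟨_, mem_enright_of_e_eq_zero hew⟩,
          ⟨⟨coe_mem_wtSpace_iff.1 ((twistedPow_mem_wtSpace_iff hf t_even hαf n ν v).2 hv),
            (twistedPow_mem_grading_iff hgN hf).2 hg⟩, Subtype.ext hew⟩, rfl⟩
      · rintro ⟨w, ⟨⟨hw, hg⟩, he⟩, rfl⟩
        have hw' := coe_mem_wtSpace_iff.2 hw
        have he' : actOp (TwistedLoc S a N) S.e w = 0 := congrArg Subtype.val he
        have hh := (twistedLoc_wtSpace_h hN ha t_even h_mem hαf hα hw').1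
        rw [hμh] at hh
        obtain ⟨v, hv⟩ := exists_eq_twistedPow_of_e_eq_zero ha hf hh he'
        have hg' : (w : TwistedLoc S a N) ∈ TwistedLoc.grading S a gN i := hg
        rw [hv] at hw' he' hg'
        have hvν := (twistedPow_mem_wtSpace_iff hf t_even hαf n ν v).1 hw'
        refine ⟨v, ⟨⟨hvν, (twistedPow_mem_grading_iff hgN hf).1 hg'⟩, ?_⟩, hv.symm⟩
        rw [actOp_e_twistedPow, (hN.wtSpace_h h_mem hvν).1, hn, ← add_smul] at he'
        rw [h0, zero_smul, map_zero, smul_zero, add_zero] at he'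
        exact twistedPow_injective hf n (he'.trans (map_zero _).symm)
    rw [(Submodule.equivMapOfInjective _ (twistedPow_injective hf n) _).finrank_eq, hmap]
    exact (Submodule.equivMapOfInjective ((enright S a N).subtype.restrictScalars ℂ)
      Subtype.coe_injective _).finrank_eq.symm
  · have h1 : wtSpace N t ν ⊓ gN i ⊓ LinearMap.ker (actOp N S.e) = ⊥ := by
      rw [eq_bot_iff]
      rintro v ⟨⟨hv, -⟩, -⟩
      by_contra hne
      obtain ⟨n, hn⟩ := (hN.wtSpace_h h_mem hv).2 hne
      exact hν ⟨n + 1, by push_cast; linear_combination hn⟩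
    have h2 : wtSpace (enright S a N) t (reflectWt ⟨S.h, h_mem⟩ α ν - α)
          ⊓ enrightGrading S a gN i ⊓ LinearMap.ker (actOp (enright S a N) S.e) = ⊥ := by
      rw [eq_bot_iff]
      rintro v ⟨⟨hv, -⟩, -⟩
      by_contra hne
      obtain ⟨n, hn⟩ := (twistedLoc_wtSpace_h hN ha t_even h_mem hαf hα
        (coe_mem_wtSpace_iff.2 hv)).2 fun h => hne (Subtype.ext h)
      simp only [LinearMap.sub_apply, reflectWt_apply, hα] at hn
      exact hν ⟨-n - 1, by push_cast; linear_combination -hn⟩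
    rw [h1, h2, finrank_bot, finrank_bot]

end SingularDimension

/-! ### An odd square root of `e` in `osp(1|2)`. -/

section Osp

variable {g : Type*} [AddCommGroup g] [Module ℂ g] [LieSuperalgebra g]

theorem lie_eq_br (x y : g) : ⁅x, y⁆ = br x y := rfl

theorem br_skew_even {x y : g} (hx : x ∈ gr (g := g) 0) {j : ZMod 2} (hy : y ∈ gr (g := g) j) :
    br x y = -br y x := by
  rw [br_skew hx hy, koszulSign, if_neg (by simp), one_smul]

theorem br_comm_odd {x y : g} (hx : x ∈ gr (g := g) 1) (hy : y ∈ gr (g := g) 1) :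
    br x y = br y x := by
  rw [br_skew hx hy, koszulSign, if_pos ⟨rfl, rfl⟩, neg_smul, one_smul, neg_neg]

/-- A binary quadratic form of zero discriminant is the square of a linear form. Since (pE + qF)² =
p² e + pq h - q² f, this extracts odd square roots of nilpotent elements. -/
theorem exists_sqrt_of_sq_add_mul_eq_zero {x y z : ℂ} (h : y ^ 2 + x * z = 0) :
    ∃ p q : ℂ, p ^ 2 = x ∧ p * q = y ∧ q ^ 2 = -z := by
  obtain ⟨p, hp⟩ := IsAlgClosed.exists_pow_nat_eq x two_pos
  by_cases hp0 : p = 0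
  · obtain ⟨q, hq⟩ := IsAlgClosed.exists_pow_nat_eq (-z) two_pos
    subst hp0
    have hx : x = 0 := by rw [← hp]; norm_num
    have hy : y = 0 := by
      rw [hx, zero_mul, add_zero] at h
      exact pow_eq_zero_iff two_ne_zero |>.1 h
    exact ⟨0, q, hp, by rw [hy, zero_mul], hq⟩
  · refine ⟨p, y / p, hp, by field_simp, ?_⟩
    have hx : x ≠ 0 := by rw [← hp]; positivity
    rw [div_pow, hp]
    field_simp
    linear_combination h

variable {e h f E F : g}

/-- The three vectors have distinct `ad h`-eigenvalues 2, 0, -2; applying `ad h` once and twice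
isolates the outer two. -/
theorem IsOspBasis.linearIndependent (H : IsOspBasis e h f E F) (h0 : h ≠ 0) {A B C : ℂ}
    (hABC : A • e + B • h + C • f = 0) (h_even : h ∈ gr (g := g) 0) : A = 0 ∧ B = 0 ∧ C = 0 := by
  have he0 : e ≠ 0 := fun h => h0 (by rw [← H.lie_e_f, h, lie_eq_br, map_zero]; rfl)
  have hf0 : f ≠ 0 := fun h => h0 (by rw [← H.lie_e_f, h, lie_eq_br, map_zero])
  have hhe : br h e = (2 : ℂ) • e := H.lie_h_e
  have hhf : br h f = -((2 : ℂ) • f) := H.lie_h_f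
  have hhh : br h h = 0 := by
    have := br_skew_even h_even h_even
    have h2 : (2 : ℂ) • br h h = 0 := by
      rw [two_smul]; nth_rewrite 1 [this]; exact neg_add_cancel _
    exact (smul_eq_zero.1 h2).resolve_left two_ne_zero
  have h1 := congrArg (br h) hABC
  simp only [map_add, map_smul, map_zero, hhe, hhf, hhh, smul_zero, add_zero] at h1
  have h2 := congrArg (br h) h1
  simp only [map_add, map_smul, map_zero, map_neg, hhe, hhf] at h2
  have hA : (8 * A) • e = 0 := by
    have : (8 * A) • e = (2 : ℂ) • (A • (2 : ℂ) • e + C • -((2 : ℂ) • f))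
        + (A • (2 : ℂ) • (2 : ℂ) • e + C • -((2 : ℂ) • -((2 : ℂ) • f))) := by module
    rw [this, h1, h2, smul_zero, add_zero]
  have hC : (8 * C) • f = 0 := by
    have : (8 * C) • f = (A • (2 : ℂ) • (2 : ℂ) • e + C • -((2 : ℂ) • -((2 : ℂ) • f)))
        - (2 : ℂ) • (A • (2 : ℂ) • e + C • -((2 : ℂ) • f)) := by module
    rw [this, h1, h2, smul_zero, sub_zero]
  have hA : A = 0 := by simpa [he0] using hA
  have hC : C = 0 := by simpa [hf0] using hC
  subst hA hC
  refine ⟨rfl, ?_, rfl⟩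
  simpa [h0] using hABC

theorem br_self_even {x : g} (hx : x ∈ gr (g := g) 0) : br x x = 0 := by
  have h2 : (2 : ℂ) • br x x = 0 := by
    rw [two_smul]; nth_rewrite 1 [br_skew_even hx hx]; exact neg_add_cancel _
  exact (smul_eq_zero.1 h2).resolve_left two_ne_zero

theorem IsOspBasis.br_even (H : IsOspBasis e h f E F) (he : e ∈ gr (g := g) 0)
    (hh : h ∈ gr (g := g) 0) (hf : f ∈ gr (g := g) 0) (x y z x' y' z' : ℂ) :
    br (x • e + y • h + z • f) (x' • e + y' • h + z' • f)
      = (2 * (y * x' - x * y')) • e + (x * z' - z * x') • h + (2 * (z * y' - y * z')) • f := by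
  have hhe : br h e = (2 : ℂ) • e := H.lie_h_e
  have hhf : br h f = -((2 : ℂ) • f) := H.lie_h_f
  have hef : br e f = h := H.lie_e_f
  have heh : br e h = -((2 : ℂ) • e) := by rw [br_skew_even he hh, hhe]
  have hfh : br f h = (2 : ℂ) • f := by rw [br_skew_even hf hh, hhf, neg_neg]
  have hfe : br f e = -h := by rw [br_skew_even hf he, hef]
  simp only [map_add, LinearMap.add_apply, map_smul, LinearMap.smul_apply, hhe, hhf, hef, heh, hfh,
    hfe, br_self_even he, br_self_even hh, br_self_even hf]
  module

theorem IsOspBasis.br_odd (H : IsOspBasis e h f E F) (p q p' q' : ℂ) :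
    br (p • E + q • F) (p' • E + q' • F)
      = (2 * (p * p')) • e + (p * q' + q * p') • h + (-2 * (q * q')) • f := by
  have hEE : br E E = (2 : ℂ) • e := H.lie_E_E
  have hFF : br F F = -((2 : ℂ) • f) := H.lie_F_F
  have hEF : br E F = h := H.lie_E_F
  have hFE : br F E = h := by rw [br_comm_odd H.F_odd H.E_odd, hEF]
  simp only [map_add, LinearMap.add_apply, map_smul, LinearMap.smul_apply, hEE, hFF, hEF, hFE]
  module

theorem disjoint_gr : Disjoint (gr (g := g) 0) (gr (g := g) 1) :=
  (gr_internal (g := g)).submodule_iSupIndep.pairwiseDisjoint (by decide)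

/-- An `ad t`-stable `osp(1|2)` with even part `sl₂(α)` contains an odd root vector of weight
`α/2` whose square is `e`. -/
theorem ContainsOsp.exists_odd_root_vector {S : Sl2Copy g} {t : Submodule ℂ g}
    (hS : ContainsOsp S t) (t_even : t ≤ gr 0) {α : Module.Dual ℂ t}
    (hαe : ∀ x : t, ⁅(x : g), S.e⁆ = α x • S.e) :
    ∃ E ∈ gr (g := g) 1, ⁅E, E⁆ = (2 : ℂ) • S.e ∧
      ∀ x : t, ⁅(x : g), E⁆ = ((1 / 2 : ℂ) • α) x • E := by
  obtain ⟨e, h, f, E, F, H, hspan, hstab⟩ := hS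
  have hS0 : S.e ≠ 0 := fun h0 => S.h_ne_zero (by
    rw [← S.lie_e_f, h0, lie_eq_br, map_zero]; rfl)
  have heven : Submodule.span ℂ {e, h, f} ≤ gr (g := g) 0 := by
    rw [hspan, Submodule.span_le]
    rintro _ (rfl | rfl | rfl)
    exacts [S.e_even, S.h_even, S.f_even]
  have he := heven (Submodule.subset_span (by simp : e ∈ ({e, h, f} : Set g)))
  have hh := heven (Submodule.subset_span (by simp : h ∈ ({e, h, f} : Set g)))
  have hf := heven (Submodule.subset_span (by simp : f ∈ ({e, h, f} : Set g)))
  obtain ⟨x, y, z, hxyz⟩ := Submodule.mem_span_triple.1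
    (hspan ▸ Submodule.subset_span (by simp) : S.e ∈ Submodule.span ℂ {e, h, f})
  obtain ⟨x', y', z', hxyz'⟩ := Submodule.mem_span_triple.1
    (hspan ▸ Submodule.subset_span (by simp) : S.h ∈ Submodule.span ℂ {e, h, f})
  have h0 : h ≠ 0 := by
    rintro rfl
    have he0 : e = 0 := by
      have := H.lie_h_e
      rw [lie_eq_br, map_zero] at this
      exact (smul_eq_zero.1 this.symm).resolve_left two_ne_zero
    have hf0 : f = 0 := by
      have := H.lie_h_f
      rw [lie_eq_br, map_zero] at this
      exact (smul_eq_zero.1 (neg_eq_zero.1 this.symm)).resolve_left two_ne_zero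
    exact hS0 (by rw [← hxyz, he0, hf0]; simp)
  -- In `sl₂` one has (ad X)³ = 4(y² + xz) ad X for X = xe + yh + zf. For X = `S.e` the left side
  -- kills `S.h`, while `[S.e, S.h] = -2 S.e` is nonzero.
  have hnil : y ^ 2 + x * z = 0 := by
    have h1 : br S.e S.h = -((2 : ℂ) • S.e) := by
      rw [br_skew_even S.e_even S.h_even]; exact congrArg Neg.neg S.lie_h_e
    have h2 : br S.e (br S.e (br S.e S.h)) = (4 * (y ^ 2 + x * z)) • br S.e S.h := by
      rw [← hxyz, ← hxyz']
      simp only [H.br_even he hh hf]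
      module
    rw [h1, map_neg, map_smul, br_self_even S.e_even, smul_zero, neg_zero, map_zero, smul_neg,
      smul_smul] at h2
    have h3 := (smul_eq_zero.1 (neg_eq_zero.1 h2.symm)).resolve_right hS0
    linear_combination h3 / 8
  obtain ⟨p, q, hp, hpq, hq⟩ := exists_sqrt_of_sq_add_mul_eq_zero hnil
  have hodd : ∀ p q : ℂ, p • E + q • F ∈ gr (g := g) 1 := fun p q =>
    add_mem (Submodule.smul_mem _ _ H.E_odd) (Submodule.smul_mem _ _ H.F_odd)
  have hsq : br (p • E + q • F) (p • E + q • F) = (2 : ℂ) • S.e := by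
    rw [H.br_odd, ← hxyz, ← hp, ← hpq, ← neg_eq_iff_eq_neg.2 hq]
    module
  refine ⟨p • E + q • F, hodd p q, hsq, fun w => ?_⟩
  have hw := hstab w w.2 (p • E + q • F) (add_mem
    (Submodule.smul_mem _ _ (Submodule.subset_span (by simp)))
    (Submodule.smul_mem _ _ (Submodule.subset_span (by simp))))
  have hset : ({e, h, f, E, F} : Set g) = {e, h, f} ∪ {E, F} := by
    ext; simp only [Set.mem_insert_iff, Set.mem_singleton_iff, Set.mem_union]; tauto
  rw [hset, Submodule.span_union] at hw
  obtain ⟨s, hs, o, ho, hso⟩ := Submodule.mem_sup.1 hw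
  obtain ⟨u, v, rfl⟩ := Submodule.mem_span_pair.1 ho
  -- Stability only places the bracket in `osp(1|2)`; its even component vanishes by parity.
  have hs0 : s = 0 := by
    refine Submodule.disjoint_def.1 disjoint_gr s (heven hs) ?_
    rw [eq_sub_of_add_eq hso]
    exact sub_mem (zero_add (1 : ZMod 2) ▸ br_mem (t_even w.2) (hodd p q)) (hodd u v)
  rw [hs0, zero_add] at hso
  have hj := br_jacobi (p • E + q • F) (t_even w.2) (hodd p q)
  have hwe : br (w : g) S.e = α w • S.e := hαe w
  have hwE : br (w : g) (p • E + q • F) = u • E + v • F := hso.symm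
  rw [koszulSign, if_neg (by simp), one_smul, hwE, hsq, map_smul, hwe,
    br_comm_odd (hodd p q) (hodd u v), ← two_smul ℂ] at hj
  have hj' := smul_right_injective g (two_ne_zero' ℂ) hj
  -- By Jacobi, `[w, E']` and `α(w)/2 · E'` have the same bracket with E' = pE + qF. Bracketing with
  -- a nonzero odd element is injective on the span of `E` and `F`, so the two agree.
  have hD : br ((u - α w / 2 * p) • E + (v - α w / 2 * q) • F) (p • E + q • F) = 0 := by
    have : (u - α w / 2 * p) • E + (v - α w / 2 * q) • F
        = u • E + v • F - (α w / 2) • (p • E + q • F) := by module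
    rw [this, map_sub, LinearMap.sub_apply, map_smul, LinearMap.smul_apply, hsq, ← hj']
    module
  rw [H.br_odd] at hD
  obtain ⟨hA, hB, hC⟩ := H.linearIndependent h0 hD hh
  have hpq0 : p ≠ 0 ∨ q ≠ 0 := by
    by_contra! hcon
    refine hS0 ?_
    rw [hcon.1, hcon.2] at hsq
    simpa using hsq.symm
  have huv : u - α w / 2 * p = 0 ∧ v - α w / 2 * q = 0 := by
    rcases hpq0 with hp0 | hq0
    · have hu : u - α w / 2 * p = 0 := by simpa [hp0] using hA
      rw [hu, zero_mul, zero_add] at hB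
      exact ⟨hu, by simpa [hp0] using hB⟩
    · have hv : v - α w / 2 * q = 0 := by simpa [hq0] using hC
      rw [hv, zero_mul, add_zero] at hB
      exact ⟨by simpa [hq0] using hB, hv⟩
  rw [← hso, sub_eq_zero.1 huv.1, sub_eq_zero.1 huv.2, LinearMap.smul_apply, smul_eq_mul]
  module

end Osp

/-! ### Assembly of the two character identities. -/

theorem chEps_eq_zeps {g : Type*} [AddCommGroup g] [Module ℂ g] [LieSuperalgebra g]
    {N : Type*} [AddCommGroup N] [Module (SuperU g) N] [Module ℂ N]
    [IsScalarTower ℂ (SuperU g) N] (t : Submodule ℂ g) (gN : ZMod 2 → Submodule ℂ N)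
    (ν : Module.Dual ℂ t) :
    chEps t gN ν = zeps (Module.finrank ℂ ↥(wtSpace N t ν ⊓ gN 0))
      (Module.finrank ℂ ↥(wtSpace N t ν ⊓ gN 1)) := rfl

end

theorem mainTheorem9 {g : Type*} [AddCommGroup g] [Module ℂ g] [LieSuperalgebra g]
    (S : Sl2Copy g) (t : Submodule ℂ g)
    (t_even : t ≤ LieSuperalgebra.gr 0) (t_abelian : ∀ x ∈ t, ∀ y ∈ t, ⁅x, y⁆ = 0)
    (h_mem : S.h ∈ t) (α : Module.Dual ℂ t)
    (hαe : ∀ x : t, ⁅(x : g), S.e⁆ = α x • S.e)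
    (hαf : ∀ x : t, ⁅(x : g), S.f⁆ = -(α x • S.f))
    (a : ℂ) (ha : ∀ n : ℤ, a ≠ n)
    {N : Type*} [AddCommGroup N] [Module (SuperU g) N] [Module ℂ N]
    [IsScalarTower ℂ (SuperU g) N]
    (gN : ZMod 2 → Submodule ℂ N) (hgN : IsSuperGrading (g := g) gN)
    (hN : IsInMe N S a) (hchN : AdmitsChar N t) (hchC : AdmitsChar (enright S a N) t) :
    FiniteSum.act (fexp ((1 / 2 : ℂ) • α) * (1 - fexp (-α)))
        (chEps t (enrightGrading S a gN))
      = FormalSum.reflect ⟨S.h, h_mem⟩ α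
          (FiniteSum.act (fexp ((1 / 2 : ℂ) • α) * (1 - fexp (-α))) (chEps t gN)) ∧
    (ContainsOsp S t →
      FiniteSum.act (fexp ((1 / 4 : ℂ) • α) * (1 - fepsilon * fexp (-((1 / 2 : ℂ) • α))))
          (chEps t (enrightGrading S a gN))
        = FiniteSum.act fepsilon (FormalSum.reflect ⟨S.h, h_mem⟩ α
            (FiniteSum.act
              (fexp ((1 / 4 : ℂ) • α) * (1 - fepsilon * fexp (-((1 / 2 : ℂ) • α))))
              (chEps t gN)))) := by

  have hf := hN.f_injective ha
  have hα : α ⟨S.h, h_mem⟩ = 2 := by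
    have hS0 : S.e ≠ 0 := fun h0 => S.h_ne_zero (by
      rw [← S.lie_e_f, h0, lie_eq_br, map_zero]; rfl)
    exact smul_left_injective ℂ hS0 ((hαe ⟨S.h, h_mem⟩).symm.trans S.lie_h_e)
  set r := reflectWt (⟨S.h, h_mem⟩ : t) α with hr
  have hNw := hN.hasNonintegralWeights (t := t) ha h_mem
  have hCw := enright_hasNonintegralWeights hN ha t_even h_mem hαf hα
  have hNmem : ∀ i {x : g}, x ∈ LieSuperalgebra.gr (g := g) 0 → ∀ v ∈ gN i, actOp N x v ∈ gN i :=
    fun i x hx v hv => hgN.even_act_mem hx hv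
  have hCmem : ∀ i {x : g}, x ∈ LieSuperalgebra.gr (g := g) 0 → ∀ v ∈ enrightGrading S a gN i,
      actOp (enright S a N) x v ∈ enrightGrading S a gN i := fun i x hx v hv => by
    simpa using actOp_mem_enrightGrading hgN hf hx hv
  let dN : Module.Dual ℂ t → ZMod 2 → ℤ := fun ν i => Module.finrank ℂ ↥(wtSpace N t ν ⊓ gN i)
  let dC : Module.Dual ℂ t → ZMod 2 → ℤ := fun ν i =>
    Module.finrank ℂ ↥(wtSpace (enright S a N) t ν ⊓ enrightGrading S a gN i)
  have hchN' : ∀ ν, chEps t gN ν = zeps (dN ν 0) (dN ν 1) := fun ν => chEps_eq_zeps t gN ν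
  have hchC' : ∀ ν, chEps t (enrightGrading S a gN) ν = zeps (dC ν 0) (dC ν 1) :=
    fun ν => chEps_eq_zeps t (enrightGrading S a gN) ν
  -- Both differences are dimensions of kernels of `e`, matched by `finrank_ker_e_eq`.
  have hK : ∀ ν i, dC (r ν - α) i - dC (r ν) i = dN ν i - dN (ν + α) i := fun ν i => by
    have h1 := finrank_wtSpace_eq hNw t_even hαe hαf (hNmem i S.e_even) (hNmem i S.f_even)
      hchN.finite ν
    have h2 := finrank_wtSpace_eq hCw t_even hαe hαf (hCmem i S.e_even) (hCmem i S.f_even)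
      hchC.finite (r ν - α)
    rw [finrank_ker_e_eq hN ha t_even h_mem hαf hα hgN ν i, ← hr] at h1
    rw [sub_add_cancel] at h2
    simp only [dN, dC]
    omega
  have hrr : ∀ ν, r (r ν) = ν := reflectWt_reflectWt hα
  have hrα : ∀ ν (c : ℂ), r (ν + c • α) = r ν - c • α := fun ν c => by
    ext x
    simp only [hr, reflectWt_apply, LinearMap.add_apply, LinearMap.sub_apply, LinearMap.smul_apply,
      smul_eq_mul, hα]
    ring
  refine ⟨?_, fun hosp => ?_⟩
  · funext ν
    rw [FormalSum.reflect_apply hα, act_fexp_mul_one_sub, act_fexp_mul_one_sub]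
    have e1 : ∀ ν : Module.Dual ℂ t, ν - ((1 / 2 : ℂ) • α + -α) = ν - (1 / 2 : ℂ) • α + α :=
      fun ν => by module
    have e2 : r (r ν - (1 / 2 : ℂ) • α) = ν + (1 / 2 : ℂ) • α := by
      rw [sub_eq_add_neg, ← neg_smul, hrα, hrr]; module
    have e3 : ν + (1 / 2 : ℂ) • α - α = ν - (1 / 2 : ℂ) • α := by module
    have e4 : ν - (1 / 2 : ℂ) • α + α = ν + (1 / 2 : ℂ) • α := by module
    -- The factor e^{α/2} centres the difference: the coefficient at ν compares ν - α/2 with ν +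
    -- α/2.
    have hK' := hK (r ν - (1 / 2 : ℂ) • α)
    rw [e2, e3] at hK'
    rw [e1, e1, e4, hchC', hchC', hchN', hchN', zeps_sub, zeps_sub, hK', hK']
  · obtain ⟨E, hE, hEE, hαE⟩ := hosp.exists_odd_root_vector t_even hαe
    have hi : ∀ i : ZMod 2, 1 + (i + 1) = i := by decide
    have hNdec : ∀ ν i, dN (ν + (1 / 2 : ℂ) • α) (i + 1) ≤ dN ν i := fun ν i => by
      refine Int.ofNat_le.2 (finrank_wtSpace_half_le hNw t_even hαe hαf (hNmem _ S.e_even)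
        (hNmem _ S.f_even) hchN.finite hE hEE hαE (fun v hv => ?_) ν)
      have := hgN.act_mem hE hv
      rwa [hi] at this
    have hCdec : ∀ ν i, dC (ν + (1 / 2 : ℂ) • α) (i + 1) ≤ dC ν i := fun ν i => by
      refine Int.ofNat_le.2 (finrank_wtSpace_half_le hCw t_even hαe hαf (hCmem _ S.e_even)
        (hCmem _ S.f_even) hchC.finite hE hEE hαE (fun v hv => ?_) ν)
      have := actOp_mem_enrightGrading hgN hf hE hv
      rwa [hi] at this
    have key := half_decrement_eq hrr hrα (fun ν i => Int.natCast_nonneg _) hNdec hCdec hK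
    funext ν
    rw [act_fepsilon, FormalSum.reflect_apply hα, act_fexp_mul_one_sub_fepsilon,
      act_fexp_mul_one_sub_fepsilon]
    have e1 : ∀ ν : Module.Dual ℂ t, ν - ((1 / 4 : ℂ) • α + -((1 / 2 : ℂ) • α))
      = ν + (1 / 4 : ℂ) • α := fun ν => by module
    have e2 : r (ν - (1 / 4 : ℂ) • α) = r ν + (1 / 4 : ℂ) • α := by
      rw [sub_eq_add_neg, ← neg_smul, hrα]; module
    have e3 : ν - (1 / 4 : ℂ) • α + (1 / 2 : ℂ) • α = ν + (1 / 4 : ℂ) • α := by module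
    have e4 : r ν + (1 / 4 : ℂ) • α - (1 / 2 : ℂ) • α = r ν - (1 / 4 : ℂ) • α := by module
    -- Centring by α/4 now compares ν - α/4 with ν + α/4. The inner ε swaps parities across the
    -- half-step, and the outer ε accounts for the swap between the two sides of `key`.
    have key' := key (ν - (1 / 4 : ℂ) • α)
    rw [e2, e3, e4] at key'
    have k0 := key' 0
    have k1 := key' 1
    have e5 : (1 : ZMod 2) + 1 = 0 := rfl
    rw [zero_add] at k0
    rw [e5] at k1
    rw [e1, e1, hchC', hchC', hchN', hchN', epsilon_mul_zeps, epsilon_mul_zeps, zeps_sub, zeps_sub,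
      epsilon_mul_zeps, k0, k1]
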